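/- For a countable first-order language $\mathcal L$, let $\mathrm{Mod}(\mathcal L)$ be the Polish space of $\mathcal L$-structures with domain $\omega$. An $\mathcal L_{\omega_1\omega}$-elementary class is a set $\mathcal C\subseteq \mathrm{Mod}(\mathcal L)$ consisting of all models (with domain $\omega$) of some $\mathcal L_{\omega_1\omega}$-sentence; $\cong_{\mathcal C}$, $\sqsubseteq_{\mathcal C}$ and $\equiv_{\mathcal C}$ denote the relations of isomorphism, embeddability and bi-embeddability on $\mathcal C$. For binary relations $E$ on $X$ and $F$ on $Y$, a Borel reduction of $E$ to $F$ is a Borel map $f\colon X\to Y$ with $x\,E\,x' \iff f(x)\,F\,f(x')$ for all $x,x'\in X$; $E\sim_B F$ means that there are Borel reductions in both directions. If $E,F$ are equivalence relations, $E\simeq_{cB}F$ means that there are Borel reductions of $E$ to $F$ and of $F$ to $E$ that induce mutually inverse bijections between $X/E$ and $Y/F$. An isomorphism relation is a relation $\cong_{\mathcal D}$, for $\mathcal D$ an $\mathcal L_{\omega_1\omega}$-elementary class in some countable language $\mathcal L$; a quasi-isomorphism relation is a relation on a standard Borel space that is Borel bireducible with some isomorphism relation. $\mathrm{id}(1)$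 is the equality relation on a one-point space. A set-theoretical tree is a partially ordered set in which the strict predecessors of every element are well-ordered; an ordered set-theoretical tree is a set-theoretical tree with an extra transitive binary relation on its nodes, called its order. **Theorem 3.1.** Let $E$ be a quasi-isomorphism relation on a nonempty standard Borel space. Then there is an $\mathcal L_{\omega_1\omega}$-elementary class $\mathcal C$, in the language $\mathcal L$ with two binary relation symbols, consisting of ordered set-theoretical trees whose order is an equivalence relation, such that $E\sim_B{\cong_{\mathcal C}}$, any two members of $\mathcal C$ embed into each other, so that ${\sqsubseteq_{\mathcal C}}={\equiv_{\mathcal C}}$, and ${\equiv_{\mathcal C}}\sim_B \mathrm{id}(1)$. Moreover, $\mathcal C$ can be chosen so that in addition $E\simeq_{cB}{\cong_{\mathcal C}}$ if $E$ itself is an isomorphism relation. -/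

import Mathlib

namespace Linf

universe u v

/-- Formulas of the infinitary logic `L_{ω₁ω}` over the language `L` with free variables among
`x₀, …, x_{n-1}`: closed under negation, countable conjunctions and quantification over one
element.  (Disjunctions, finite conjunctions and `∃` are definable in the usual way.) -/
inductive Formula (L : FirstOrder.Language.{u, v}) : ℕ → Type (max u v)
  | equal {n : ℕ} (t₁ t₂ : L.Term (Fin n)) : Formula L n
  | rel {n k : ℕ} (R : L.Relations k) (ts : Fin k → L.Term (Fin n)) : Formula L n
  | neg {n : ℕ} (φ : Formula L n) : Formula L n
  | conj {n : ℕ} (φ : ℕ → Formula L n) : Formula L n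
  | all {n : ℕ} (φ : Formula L (n + 1)) : Formula L n

/-- Tarskian satisfaction of an `L_{ω₁ω}`-formula in an `L`-structure `A`; the quantifier `all`
binds the last variable. -/
def Formula.Realize {L : FirstOrder.Language.{u, v}} (A : Type*) [L.Structure A] :
    {n : ℕ} → Formula L n → (Fin n → A) → Prop
  | _, .equal t₁ t₂, w => t₁.realize w = t₂.realize w
  | _, .rel R ts, w => FirstOrder.Language.Structure.RelMap R fun i => (ts i).realize w
  | _, .neg φ, w => ¬ φ.Realize A w
  | _, .conj φ, w => ∀ i, (φ i).Realize A w
  | _, .all φ, w => ∀ a : A, φ.Realize A (Fin.snoc w a)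

/-- Sentences of `L_{ω₁ω}`. -/
abbrev Sentence (L : FirstOrder.Language.{u, v}) := Formula L 0

/-- `Mod(L)`: the space of `L`-structures with domain `ω`. -/
abbrev Mod (L : FirstOrder.Language.{u, v}) := L.Structure ℕ

/-- The usual (Polish, if `L` is countable) topology of `Mod(L)`: the coarsest one in which the
truth value of every `R(a₁, …, a_k)` and the value of every `f(a₁, …, a_k)` depends continuously on
the structure (truth values and elements of `ω` being discrete). -/
instance instTopologicalSpaceMod (L : FirstOrder.Language.{u, v}) : TopologicalSpace (Mod L) :=
  TopologicalSpace.generateFrom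
    ({U | ∃ (k : ℕ) (R : L.Relations k) (a : Fin k → ℕ), U = {M : Mod L | M.RelMap R a}} ∪
     {U | ∃ (k : ℕ) (R : L.Relations k) (a : Fin k → ℕ), U = {M : Mod L | ¬ M.RelMap R a}} ∪
     {U | ∃ (k : ℕ) (f : L.Functions k) (a : Fin k → ℕ) (b : ℕ),
        U = {M : Mod L | M.funMap f a = b}})

/-- The Borel σ-algebra of `Mod(L)`. -/
instance instMeasurableSpaceMod (L : FirstOrder.Language.{u, v}) : MeasurableSpace (Mod L) :=
  borel (Mod L)

/-- A class of structures on `ω` is `L_{ω₁ω}`-elementary if it consists of all models (with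
domain `ω`) of some `L_{ω₁ω}`-sentence. -/
def IsElementaryClass {L : FirstOrder.Language.{u, v}} (C : Set (Mod L)) : Prop :=
  ∃ φ : Sentence L, C = {M : Mod L | @Formula.Realize L ℕ M 0 φ Fin.elim0}

/-- The isomorphism relation `≅_C` on `C`. -/
def isoRel {L : FirstOrder.Language.{u, v}} (C : Set (Mod L)) : C → C → Prop :=
  fun M N => Nonempty (@FirstOrder.Language.Equiv L ℕ ℕ M.1 N.1)

/-- The relation `⊑_C` of (logical) embeddability on `C`. -/
def embedRel {L : FirstOrder.Language.{u, v}} (C : Set (Mod L)) : C → C → Prop :=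
  fun M N => Nonempty (@FirstOrder.Language.Embedding L ℕ ℕ M.1 N.1)

/-- The relation `≡_C` of bi-embeddability on `C`. -/
def biembedRel {L : FirstOrder.Language.{u, v}} (C : Set (Mod L)) : C → C → Prop :=
  fun M N => embedRel C M N ∧ embedRel C N M

section Reducibility

variable {X Y : Type*} [MeasurableSpace X] [MeasurableSpace Y]

/-- `f` is a Borel reduction of `E` to `F`. -/
def IsBorelReduction (E : X → X → Prop) (F : Y → Y → Prop) (f : X → Y) : Prop :=
  Measurable f ∧ ∀ x x', E x x' ↔ F (f x) (f x')

/-- Borel reducibility `E ≤_B F`. -/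
def BorelReducible (E : X → X → Prop) (F : Y → Y → Prop) : Prop :=
  ∃ f : X → Y, IsBorelReduction E F f

/-- Borel bireducibility `E ∼_B F`. -/
def BorelBireducible (E : X → X → Prop) (F : Y → Y → Prop) : Prop :=
  BorelReducible E F ∧ BorelReducible F E

/-- Classwise Borel isomorphism `E ≃_cB F` of equivalence relations: there are Borel reductions
`f` of `E` to `F` and `g` of `F` to `E` whose factorings to the quotients `X/E` and `Y/F` are
inverse to each other (hence bijections). -/
def ClasswiseBorelIso (E : X → X → Prop) (F : Y → Y → Prop) : Prop :=
  ∃ (f : X → Y) (g : Y → X), IsBorelReduction E F f ∧ IsBorelReduction F E g ∧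
    (∀ x, E (g (f x)) x) ∧ ∀ y, F (f (g y)) y

/-- `E` is an isomorphism relation: it is `≅_D` for an `L_{ω₁ω}`-elementary class `D` in some
countable language, where the domain `X` of `E` is identified with the standard Borel space `D`. -/
def IsIsomorphismRelation (E : X → X → Prop) : Prop :=
  ∃ (L : FirstOrder.Language.{0, 0}) (_ : Countable L.Symbols) (D : Set (Mod L)) (_ : IsElementaryClass D)
    (e : X ≃ᵐ D), ∀ x x', E x x' ↔ isoRel D (e x) (e x')

/-- `E` is a quasi-isomorphism relation: it is Borel bireducible with `≅_D` for an
`L_{ω₁ω}`-elementary class `D` in some countable language.  (Such an `E` is automatically an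
equivalence relation, and analytic if `X` is standard Borel.) -/
def IsQuasiIsomorphismRelation (E : X → X → Prop) : Prop :=
  ∃ (L : FirstOrder.Language.{0, 0}) (_ : Countable L.Symbols) (D : Set (Mod L)),
    IsElementaryClass D ∧ BorelBireducible E (isoRel D)

end Reducibility

/-- `id(n)`: equality on an `n`-element space. -/
def idRel (n : ℕ) : Fin n → Fin n → Prop := fun i j => i = j

/-- The two binary relation symbols of the language of ordered graphs. -/
inductive OrdGraphRel : ℕ → Type
  | graph : OrdGraphRel 2
  | order : OrdGraphRel 2

/-- The language of ordered graphs: two binary relation symbols. -/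
def ordGraph : FirstOrder.Language.{0, 0} := ⟨fun _ => Empty, OrdGraphRel⟩

/-- The first relation of a structure in the language of ordered graphs. -/
def graphRel (M : Mod ordGraph) (a b : ℕ) : Prop :=
  M.RelMap (n := 2) OrdGraphRel.graph ![a, b]

/-- The second relation (the "order") of a structure in the language of ordered graphs. -/
def orderRel (M : Mod ordGraph) (a b : ℕ) : Prop :=
  M.RelMap (n := 2) OrdGraphRel.order ![a, b]

/-- `r` is (the non-strict order of) a set-theoretical tree: a partial order in which the strict
predecessors of every node are well-ordered. -/
structure IsSetTheoreticalTree {A : Type*} (r : A → A → Prop) : Prop where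
  refl : ∀ a, r a a
  antisymm : ∀ a b, r a b → r b a → a = b
  trans : ∀ a b c, r a b → r b c → r a c
  wellOrdered : ∀ t, IsWellOrder {s : A // r s t ∧ s ≠ t} fun a b => r a.1 b.1 ∧ a.1 ≠ b.1

/-- An ordered set-theoretical tree: a set-theoretical tree with an extra transitive relation on
its nodes. -/
structure IsOrderedSetTheoreticalTree (M : Mod ordGraph) : Prop where
  tree : IsSetTheoreticalTree (graphRel M)
  order_trans : ∀ a b c, orderRel M a b → orderRel M b c → orderRel M a c

end Linf

/-! A countable model `M` is coded by a forest of height two with an equivalence relation, each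
class of which contains exactly one root. Such a forest amounts to a weighted digraph on its roots:
the weight of `(x, y)` in `ℕ∞` is the number of children of `x` in the class of `y`. A map of roots
extends to an embedding if it is injective and does not decrease weights, and to an isomorphism if
it is bijective and preserves them (`IsRootedForest.embedding`, `IsRootedForest.equiv`).

The roots coding `M` are its elements, all atomic statements about tuples of elements, and an
infinite kernel. Finite weights record the symbol, the truth value and the tuple of each atomic
statement. All weights into the kernel are infinite, so any injection of the roots of one code into
the kernel of another extends to an embedding: bi-embeddability is trivial (`IsCode.embedding`).
Isomorphisms preserve finite weights exactly, so they recover `M` up to isomorphism (`IsCode.equiv`,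
`IsCode.iso`).

Weights are definable in `L_{ω₁ω}`, and so is being a code (`IsCode.isCodeForest`,
`IsCodeForest.isCode_decode`). The sentence defining a class `D` translates into one about the coded
elements, so the codes of members of `D` form an elementary class (`isElementaryClass_codeClass`).
Coding and decoding are Borel and inverse up to isomorphism (`classwiseBorelIso_codeClass`). -/

namespace Linf

/-! ### Definability in `L_{ω₁ω}` and Borel measurability -/

section Definability

variable {L : FirstOrder.Language.{0, 0}}

/-- Renaming of the free variables of a formula. -/
def Formula.relabel {L : FirstOrder.Language.{0, 0}} :
    {n m : ℕ} → (Fin n → Fin m) → Formula L n → Formula L m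
  | _, _, e, .equal t₁ t₂ => .equal (t₁.relabel e) (t₂.relabel e)
  | _, _, e, .rel R ts => .rel R fun i => (ts i).relabel e
  | _, _, e, .neg φ => .neg (φ.relabel e)
  | _, _, e, .conj φ => .conj fun i => (φ i).relabel e
  | _, m, e, .all φ => .all (φ.relabel (Fin.snoc (fun i => (e i).castSucc) (Fin.last m)))

theorem Formula.realize_relabel {A : Type*} [L.Structure A] {n : ℕ} (φ : Formula L n) :
    ∀ {m : ℕ} (e : Fin n → Fin m) (w : Fin m → A),
      (φ.relabel e).Realize A w ↔ φ.Realize A (w ∘ e) := by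
  induction φ with
  | equal t₁ t₂ => intro m e w; simp [Formula.relabel, Formula.Realize]
  | rel R ts => intro m e w; simp [Formula.relabel, Formula.Realize]
  | neg φ ih => intro m e w; simp [Formula.relabel, Formula.Realize, ih]
  | conj φ ih => intro m e w; simp [Formula.relabel, Formula.Realize, ih]
  | all φ ih =>
    intro m e w
    simp only [Formula.relabel, Formula.Realize, ih]
    refine forall_congr' fun a => ?_
    have : (Fin.snoc w a : Fin (m + 1) → A) ∘
        (Fin.snoc (fun i => (e i).castSucc) (Fin.last m) : Fin _ → Fin (m + 1)) =
        Fin.snoc (w ∘ e) a := by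
      rw [Fin.comp_snoc]
      congr 1
      · funext i; simp
      · simp
    rw [this]

/-- A property of structures on `ω` and assignments is definable if it is expressed by an
`L_{ω₁ω}`-formula. -/
def InfDefinable {ι : Type} (P : Mod L → (ι → ℕ) → Prop) : Prop :=
  ∃ (n : ℕ) (φ : Formula L n) (e : Fin n → ι),
    ∀ M w, P M w ↔ @Formula.Realize L ℕ M n φ (w ∘ e)

namespace InfDefinable

variable {ι κ : Type} {P Q : Mod L → (ι → ℕ) → Prop}

theorem congr (hP : InfDefinable P) (h : ∀ M w, Q M w ↔ P M w) : InfDefinable Q := by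
  obtain ⟨n, φ, e, he⟩ := hP
  exact ⟨n, φ, e, fun M w => (h M w).trans (he M w)⟩

theorem subst (hP : InfDefinable P) (f : ι → κ) :
    InfDefinable (fun M (w : κ → ℕ) => P M (fun i => w (f i))) := by
  obtain ⟨n, φ, e, he⟩ := hP
  exact ⟨n, φ, f ∘ e, fun M w => he M _⟩

/-- Puts formulas with different numbers of variables into one common variable context, as a
countable conjunction requires. -/
theorem exists_formula (hP : InfDefinable P) {n : ℕ} (ε : Fin n ≃ ι) :
    ∃ φ : Formula L n, ∀ M w, P M w ↔ @Formula.Realize L ℕ M n φ (w ∘ ε) := by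
  obtain ⟨m, φ, e, he⟩ := hP
  refine ⟨φ.relabel (ε.symm ∘ e), fun M w => ?_⟩
  let _ := M
  rw [he, Formula.realize_relabel]
  have : (w ∘ ε) ∘ (ε.symm ∘ e) = w ∘ e := by funext i; simp
  rw [this]

theorem not (hP : InfDefinable P) : InfDefinable (fun M w => ¬ P M w) := by
  obtain ⟨n, φ, e, he⟩ := hP
  exact ⟨n, .neg φ, e, fun M w => not_congr (he M w)⟩

theorem var_eq (i j : ι) : InfDefinable (L := L) (fun _ w => w i = w j) :=
  ⟨2, .equal (.var 0) (.var 1), ![i, j], fun _ _ => Iff.rfl⟩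

theorem relMap {k : ℕ} (R : L.Relations k) (s : Fin k → ι) :
    InfDefinable (fun (M : Mod L) w => M.RelMap R fun i => w (s i)) :=
  ⟨k, .rel R fun i => .var i, s, fun _ _ => Iff.rfl⟩

variable [Finite ι]

theorem forall_nat {P : ℕ → Mod L → (ι → ℕ) → Prop} (h : ∀ k, InfDefinable (P k)) :
    InfDefinable (fun M w => ∀ k, P k M w) := by
  obtain ⟨n, ⟨ε⟩⟩ := Finite.exists_equiv_fin ι
  choose φ hφ using fun k => (h k).exists_formula ε.symm
  exact ⟨n, .conj φ, ε.symm, fun M w => forall_congr' fun k => hφ k M w⟩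

theorem forall_index {J : Type*} [Countable J] {P : J → Mod L → (ι → ℕ) → Prop}
    (h : ∀ j, InfDefinable (P j)) : InfDefinable (fun M w => ∀ j, P j M w) := by
  rcases isEmpty_or_nonempty J with hJ | hJ
  -- `conj` is indexed by `ℕ`, so the empty conjunction is replaced by the valid sentence `∀ x, x =
  -- x`.
  · refine ⟨0, .all (.equal (.var 0) (.var 0)), Fin.elim0, fun M w => ?_⟩
    simp [Formula.Realize]
  · obtain ⟨f, hf⟩ := exists_surjective_nat J
    exact (forall_nat fun k => h (f k)).congr fun M w => hf.forall

theorem exists_index {J : Type*} [Countable J] {P : J → Mod L → (ι → ℕ) → Prop}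
    (h : ∀ j, InfDefinable (P j)) : InfDefinable (fun M w => ∃ j, P j M w) :=
  (forall_index fun j => (h j).not).not.congr fun M w => by simp

theorem and (hP : InfDefinable P) (hQ : InfDefinable Q) :
    InfDefinable (fun M w => P M w ∧ Q M w) :=
  (forall_index (P := fun b : Bool => if b then P else Q)
    (by rintro (_ | _) <;> simpa)).congr fun M w => by simp [and_comm]

theorem imp (hP : InfDefinable P) (hQ : InfDefinable Q) :
    InfDefinable (fun M w => P M w → Q M w) :=
  (hP.and hQ.not).not.congr fun M w => by tauto

theorem or (hP : InfDefinable P) (hQ : InfDefinable Q) :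
    InfDefinable (fun M w => P M w ∨ Q M w) :=
  (hP.not.imp hQ).congr fun M w => by tauto

theorem iff (hP : InfDefinable P) (hQ : InfDefinable Q) :
    InfDefinable (fun M w => P M w ↔ Q M w) :=
  ((hP.imp hQ).and (hQ.imp hP)).congr fun M w => by tauto

theorem const (p : Prop) : InfDefinable (fun (_ : Mod L) (_ : ι → ℕ) => p) := by
  by_cases hp : p
  · exact (forall_index (J := Empty) (P := fun _ _ _ => True) (fun j => j.elim)).congr
      fun M w => by simp [hp]
  · exact (exists_index (J := Empty) (P := fun _ _ _ => True) (fun j => j.elim)).congr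
      fun M w => by simp [hp]

/-- The bound variable is `none` in `Option ι`; renaming sends it to the last variable, the one that
`Formula.all` binds. -/
theorem all {Q : Mod L → (ι → ℕ) → ℕ → Prop}
    (h : InfDefinable (fun M (w : Option ι → ℕ) => Q M (fun i => w (some i)) (w none))) :
    InfDefinable (fun M w => ∀ x, Q M w x) := by
  obtain ⟨N, ⟨ε⟩⟩ := Finite.exists_equiv_fin ι
  obtain ⟨n, φ, e, he⟩ := h
  let e' : Fin n → Fin (N + 1) := fun i => (e i).elim (Fin.last N) fun j => (ε j).castSucc
  refine ⟨N, .all (φ.relabel e'), ε.symm, fun M w => forall_congr' fun a => ?_⟩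
  let _ := M
  refine (he M fun o => o.elim a w).trans ?_
  rw [Formula.realize_relabel]
  have : (fun o : Option ι => o.elim a w) ∘ e = (Fin.snoc (w ∘ ε.symm) a : Fin (N + 1) → ℕ) ∘ e' := by
    funext i
    simp only [Function.comp_apply, e']
    cases e i <;> simp
  rw [this]

theorem ex {Q : Mod L → (ι → ℕ) → ℕ → Prop}
    (h : InfDefinable (fun M (w : Option ι → ℕ) => Q M (fun i => w (some i)) (w none))) :
    InfDefinable (fun M w => ∃ x, Q M w x) :=
  (all (Q := fun M w x => ¬ Q M w x) h.not).not.congr fun M w => by simp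

/-- The type `ι` varies in the induction because each step adds one entry of the tuple to the free
variables. -/
theorem all_tuple {k : ℕ} : ∀ {ι : Type} [Finite ι] {Q : Mod L → (ι → ℕ) → (Fin k → ℕ) → Prop},
    InfDefinable (fun M (w : ι ⊕ Fin k → ℕ) =>
      Q M (fun i => w (Sum.inl i)) (fun j => w (Sum.inr j))) →
    InfDefinable (fun M w => ∀ s, Q M w s) := by
  induction k with
  | zero =>
    intro ι _ Q h
    refine (h.subst (κ := ι) (Sum.elim id Fin.elim0)).congr fun M w => ?_
    simp only [Sum.elim_inl, id]
    exact ⟨fun h => h _, fun h s => by convert h⟩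
  | succ k ih =>
    intro ι _ Q h
    refine (all (Q := fun M w x => ∀ s : Fin k → ℕ, Q M w (Fin.cons x s)) ?_).congr
      fun M w => Fin.forall_fin_succ_pi
    refine ih ?_
    refine (h.subst (κ := Option ι ⊕ Fin k) (Sum.elim (fun i => Sum.inl (some i))
      (Fin.cons (Sum.inl none) Sum.inr))).congr fun M w => ?_
    have : (Fin.cons (w (Sum.inl none)) fun j => w (Sum.inr j) : Fin (k + 1) → ℕ) =
        fun j => w ((Fin.cons (Sum.inl none) Sum.inr : Fin (k + 1) → Option ι ⊕ Fin k) j) := by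
      funext j
      cases j using Fin.cases <;> simp
    simp only [this, Sum.elim_inl, Sum.elim_inr]

theorem ex_tuple {k : ℕ} {Q : Mod L → (ι → ℕ) → (Fin k → ℕ) → Prop}
    (h : InfDefinable (fun M (w : ι ⊕ Fin k → ℕ) =>
      Q M (fun i => w (Sum.inl i)) (fun j => w (Sum.inr j)))) :
    InfDefinable (fun M w => ∃ s, Q M w s) :=
  (all_tuple (Q := fun M w x => ¬ Q M w x) h.not).not.congr fun M w => by simp

theorem le_encard_iff {s : Set ℕ} {k : ℕ} :
    (k : ℕ∞) ≤ s.encard ↔ ∃ t : Fin k → ℕ, (∀ i j, t i = t j → i = j) ∧ ∀ i, t i ∈ s := by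
  constructor
  · intro h
    obtain ⟨u, hus, hu⟩ := Set.exists_subset_encard_eq h
    have hfin : u.Finite := Set.finite_of_encard_eq_coe hu
    have hc : hfin.toFinset.card = k := by
      rw [hfin.encard_eq_coe_toFinset_card] at hu
      exact_mod_cast hu
    let ε := (hfin.toFinset.equivFinOfCardEq hc).symm
    exact ⟨fun i => ε i, fun i j h => ε.injective (Subtype.ext h),
      fun i => hus (hfin.mem_toFinset.mp (ε i).2)⟩
  · rintro ⟨t, ht, hts⟩
    have hinj : Function.Injective t := fun i j => ht i j
    calc (k : ℕ∞) = (Set.univ : Set (Fin k)).encard := by simp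
      _ = (Set.range t).encard := by rw [← Set.image_univ, hinj.encard_image]
      _ ≤ s.encard := Set.encard_le_encard (by rintro _ ⟨i, rfl⟩; exact hts i)

variable {Q : Mod L → (ι → ℕ) → ℕ → Prop}

theorem le_encard
    (h : InfDefinable (fun M (w : Option ι → ℕ) => Q M (fun i => w (some i)) (w none))) (k : ℕ) :
    InfDefinable (fun M w => (k : ℕ∞) ≤ Set.encard {x | Q M w x}) := by
  refine (ex_tuple (k := k) (Q := fun M w t => (∀ i j, t i = t j → i = j) ∧ ∀ i, Q M w (t i))
    ?_).congr fun M w => le_encard_iff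
  refine and (forall_index fun i => forall_index fun j => imp (var_eq _ _) (const _))
    (forall_index fun i => ?_)
  exact h.subst (κ := ι ⊕ Fin k) fun o => o.elim (Sum.inr i) Sum.inl

theorem encard_eq
    (h : InfDefinable (fun M (w : Option ι → ℕ) => Q M (fun i => w (some i)) (w none))) (k : ℕ) :
    InfDefinable (fun M w => Set.encard {x | Q M w x} = k) := by
  refine ((le_encard h k).and (le_encard h (k + 1)).not).congr fun M w => ?_
  rw [not_le, Nat.cast_add, Nat.cast_one, ENat.lt_add_one_iff (ENat.natCast_ne_top k),
    le_antisymm_iff, and_comm]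

/-- Infinity is the conjunction of "at least `k` elements" over all `k`; this is where finitary
logic would not suffice. -/
theorem encard_eq_top
    (h : InfDefinable (fun M (w : Option ι → ℕ) => Q M (fun i => w (some i)) (w none))) :
    InfDefinable (fun M w => Set.encard {x | Q M w x} = ⊤) := by
  refine (forall_nat fun k => le_encard h k).congr fun M w => ?_
  rw [ENat.eq_top_iff_forall_ge]

end InfDefinable

instance instBorelSpaceMod : BorelSpace (Mod L) := ⟨rfl⟩

theorem measurableSet_relMap {k : ℕ} (R : L.Relations k) (a : Fin k → ℕ) :
    MeasurableSet {M : Mod L | M.RelMap R a} :=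
  (TopologicalSpace.isOpen_generateFrom_of_mem (Or.inl (Or.inl ⟨k, R, a, rfl⟩))).measurableSet

theorem measurableSet_funMap {k : ℕ} (f : L.Functions k) (a : Fin k → ℕ) (b : ℕ) :
    MeasurableSet {M : Mod L | M.funMap f a = b} :=
  (TopologicalSpace.isOpen_generateFrom_of_mem (Or.inr ⟨k, f, a, b, rfl⟩)).measurableSet

/-- A map into `Mod(L)` is Borel as soon as the preimages of the basic sets are Borel. -/
theorem measurable_to_mod [Countable L.Symbols] {Y : Type*} [MeasurableSpace Y] {g : Y → Mod L}
    (hR : ∀ (k : ℕ) (R : L.Relations k) (a : Fin k → ℕ), MeasurableSet {y | (g y).RelMap R a})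
    (hF : ∀ (k : ℕ) (f : L.Functions k) (a : Fin k → ℕ) (b : ℕ),
      MeasurableSet {y | (g y).funMap f a = b}) : Measurable g := by
  have hcF : Countable (Σ k, L.Functions k) := (Sum.inl_injective (β := Σ k, L.Relations k)).countable
  have hcR : Countable (Σ k, L.Relations k) := (Sum.inr_injective (α := Σ k, L.Functions k)).countable
  have hcF' : ∀ k, Countable (L.Functions k) := fun k =>
    (sigma_mk_injective (β := L.Functions) (i := k)).countable
  have hcR' : ∀ k, Countable (L.Relations k) := fun k =>
    (sigma_mk_injective (β := L.Relations) (i := k)).countable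
  set S : Set (Set (Mod L)) :=
    ({U | ∃ (k : ℕ) (R : L.Relations k) (a : Fin k → ℕ), U = {M : Mod L | M.RelMap R a}} ∪
     {U | ∃ (k : ℕ) (R : L.Relations k) (a : Fin k → ℕ), U = {M : Mod L | ¬ M.RelMap R a}} ∪
     {U | ∃ (k : ℕ) (f : L.Functions k) (a : Fin k → ℕ) (b : ℕ),
        U = {M : Mod L | M.funMap f a = b}}) with hS
  have hcount : S.Countable := by
    refine Set.Countable.union (Set.Countable.union ?_ ?_) ?_
    · refine (Set.countable_range fun p : Σ k, L.Relations k × (Fin k → ℕ) =>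
        {M : Mod L | M.RelMap p.2.1 p.2.2}).mono ?_
      rintro _ ⟨k, R, a, rfl⟩
      exact ⟨⟨k, R, a⟩, rfl⟩
    · refine (Set.countable_range fun p : Σ k, L.Relations k × (Fin k → ℕ) =>
        {M : Mod L | ¬ M.RelMap p.2.1 p.2.2}).mono ?_
      rintro _ ⟨k, R, a, rfl⟩
      exact ⟨⟨k, R, a⟩, rfl⟩
    · refine (Set.countable_range fun p : Σ k, L.Functions k × (Fin k → ℕ) × ℕ =>
        {M : Mod L | M.funMap p.2.1 p.2.2.1 = p.2.2.2}).mono ?_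
      rintro _ ⟨k, f, a, b, rfl⟩
      exact ⟨⟨k, f, a, b⟩, rfl⟩
  -- With a countable subbasis, the Borel σ-algebra is generated by the subbasic sets alone.
  have : SecondCountableTopology (Mod L) := ⟨⟨S, hcount, rfl⟩⟩
  have hb : instMeasurableSpaceMod L = MeasurableSpace.generateFrom S :=
    borel_eq_generateFrom_of_subbasis rfl
  rw [hb]
  refine measurable_generateFrom ?_
  rintro _ ((⟨k, R, a, rfl⟩ | ⟨k, R, a, rfl⟩) | ⟨k, f, a, b, rfl⟩)
  · exact hR k R a
  · exact (hR k R a).compl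
  · exact hF k f a b

/-- Quantifiers range over `ω` and become countable intersections. The language has no function
symbols, so every term is a variable. -/
theorem InfDefinable.measurableSet {ι : Type} {P : Mod ordGraph → (ι → ℕ) → Prop}
    (hP : InfDefinable P) (w : ι → ℕ) : MeasurableSet {M | P M w} := by
  obtain ⟨n, φ, e, he⟩ := hP
  simp only [he]
  generalize w ∘ e = v
  clear he e w
  induction φ with
  | equal t₁ t₂ =>
    rcases t₁ with i | ⟨f, _⟩
    · rcases t₂ with j | ⟨f, _⟩
      · exact MeasurableSet.const (v i = v j)
      · exact f.elim
    · exact f.elim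
  | rel R ts =>
    have : ∀ i, ∃ j, ts i = .var j := fun i => by
      rcases ts i with j | ⟨f, _⟩
      · exact ⟨j, rfl⟩
      · exact f.elim
    choose j hj using this
    obtain rfl : ts = fun i => .var (j i) := funext hj
    exact measurableSet_relMap R fun i => v (j i)
  | neg φ ih => exact (ih v).compl
  | conj φ ih =>
    simp only [Formula.Realize, Set.ofPred_forall]
    exact MeasurableSet.iInter fun i => ih i v
  | all φ ih =>
    simp only [Formula.Realize, Set.ofPred_forall]
    exact MeasurableSet.iInter fun a => ih _

end Definability

/-! ### Forests of height two, weights, and maps between them -/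

section Trees

/-- `x` has no strict predecessor. -/
def IsRoot (T : Mod ordGraph) (x : ℕ) : Prop := ∀ y, graphRel T y x → y = x

/-- The children of the root `x` that lie in the class of `y`. -/
def kids (T : Mod ordGraph) (x y : ℕ) : Set ℕ :=
  {z | graphRel T x z ∧ x ≠ z ∧ orderRel T z y}

/-- The number of children of the root `x` that lie in the class of `y`. -/
noncomputable def weight (T : Mod ordGraph) (x y : ℕ) : ℕ∞ := (kids T x y).encard

/-- `T` is a forest of height at most two together with an equivalence relation each of whose
classes contains exactly one root. -/
structure IsRootedForest (T : Mod ordGraph) : Prop where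
  refl : ∀ a, graphRel T a a
  isRoot_of_lt : ∀ a b, graphRel T a b → a ≠ b → IsRoot T a
  parent_unique : ∀ a b c, graphRel T a c → graphRel T b c → a ≠ c → b ≠ c → a = b
  equivalence : Equivalence (orderRel T)
  exists_root : ∀ z, ∃ x, IsRoot T x ∧ orderRel T z x
  root_unique : ∀ x y, IsRoot T x → IsRoot T y → orderRel T x y → x = y

/-- A node has at most one strict predecessor and there is no chain `a < b < c`, so well-ordering
and transitivity are immediate. -/
theorem IsRootedForest.isOrderedSetTheoreticalTree {T : Mod ordGraph} (hT : IsRootedForest T) :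
    IsOrderedSetTheoreticalTree T where
  tree :=
    { refl := hT.refl
      antisymm := fun a b hab hba => by
        by_contra hne
        exact hne (hT.isRoot_of_lt a b hab hne b hba).symm
      trans := fun a b c hab hbc => by
        by_cases h : a = b
        · exact h ▸ hbc
        by_cases h' : b = c
        · exact h' ▸ hab
        exact absurd (hT.isRoot_of_lt b c hbc h' a hab) h
      wellOrdered := fun t => by
        have hs : Subsingleton {s : ℕ // graphRel T s t ∧ s ≠ t} :=
          ⟨fun a b => Subtype.ext (hT.parent_unique _ _ _ a.2.1 b.2.1 a.2.2 b.2.2)⟩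
        have : Std.Irrefl fun a b : {s : ℕ // graphRel T s t ∧ s ≠ t} =>
            graphRel T a.1 b.1 ∧ a.1 ≠ b.1 := ⟨fun a h => h.2 rfl⟩
        exact Subsingleton.isWellOrder _ }
  order_trans := fun _ _ _ => hT.equivalence.trans

theorem embedding_of_rel {T T' : Mod ordGraph} (F : ℕ → ℕ) (hF : F.Injective)
    (hg : ∀ a b, graphRel T' (F a) (F b) ↔ graphRel T a b)
    (ho : ∀ a b, orderRel T' (F a) (F b) ↔ orderRel T a b) :
    Nonempty (@FirstOrder.Language.Embedding ordGraph ℕ ℕ T T') := by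
  refine ⟨@FirstOrder.Language.Embedding.mk ordGraph ℕ ℕ T T' ⟨F, hF⟩ (fun f _ => f.elim) ?_⟩
  intro n r x
  have hx : ∀ y : Fin 2 → ℕ, y = ![y 0, y 1] := fun y => by funext i; fin_cases i <;> rfl
  cases r with
  | graph =>
    have := hg (x 0) (x 1)
    unfold graphRel at this
    rw [hx x]
    rw [hx (_ ∘ _)]
    exact this
  | order =>
    have := ho (x 0) (x 1)
    unfold orderRel at this
    rw [hx x]
    rw [hx (_ ∘ _)]
    exact this

theorem equiv_of_rel {T T' : Mod ordGraph} (F : ℕ → ℕ) (hF : F.Bijective)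
    (hg : ∀ a b, graphRel T' (F a) (F b) ↔ graphRel T a b)
    (ho : ∀ a b, orderRel T' (F a) (F b) ↔ orderRel T a b) :
    Nonempty (@FirstOrder.Language.Equiv ordGraph ℕ ℕ T T') := by
  obtain ⟨e⟩ := embedding_of_rel F hF.1 hg ho
  refine ⟨@FirstOrder.Language.Equiv.mk ordGraph ℕ ℕ T T' (Equiv.ofBijective F hF)
    (fun f _ => f.elim) ?_⟩
  intro n r x
  have hx : ∀ y : Fin 2 → ℕ, y = ![y 0, y 1] := fun y => by funext i; fin_cases i <;> rfl
  cases r with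
  | graph =>
    have := hg (x 0) (x 1)
    unfold graphRel at this
    rw [hx x]
    rw [hx (_ ∘ _)]
    exact this
  | order =>
    have := ho (x 0) (x 1)
    unfold orderRel at this
    rw [hx x]
    rw [hx (_ ∘ _)]
    exact this

theorem IsRootedForest.exists_parent {T : Mod ordGraph} {z : ℕ} (hz : ¬ IsRoot T z) :
    ∃ x, graphRel T x z ∧ x ≠ z := by
  unfold IsRoot at hz
  push Not at hz
  exact hz

/-- A map of roots together with maps of the sets of children extends to a map of forests. -/
theorem IsRootedForest.glue {T T' : Mod ordGraph} (hT : IsRootedForest T)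
    (hT' : IsRootedForest T') (h : ℕ → ℕ) (g : ℕ → ℕ → ℕ → ℕ)
    (hmaps : ∀ x, IsRoot T x → IsRoot T' (h x))
    (hinj : ∀ x y, IsRoot T x → IsRoot T y → h x = h y → x = y)
    (gmaps : ∀ x y, IsRoot T x → IsRoot T y → Set.MapsTo (g x y) (kids T x y) (kids T' (h x) (h y)))
    (ginj : ∀ x y, IsRoot T x → IsRoot T y → Set.InjOn (g x y) (kids T x y)) :
    ∃ F : ℕ → ℕ, F.Injective ∧ (∀ a b, graphRel T' (F a) (F b) ↔ graphRel T a b) ∧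
      (∀ a b, orderRel T' (F a) (F b) ↔ orderRel T a b) ∧ (∀ x, IsRoot T x → F x = h x) ∧
      ∀ x y, IsRoot T x → IsRoot T y → ∀ z ∈ kids T x y, F z = g x y z := by
  classical
  choose cls hcls hcls' using hT.exists_root
  choose! par hpar hpar' using fun z => IsRootedForest.exists_parent (T := T) (z := z)
  have hparR : ∀ z, ¬ IsRoot T z → IsRoot T (par z) := fun z hz =>
    hT.isRoot_of_lt _ _ (hpar z hz) (hpar' z hz)
  have hcls_root : ∀ z, IsRoot T z → cls z = z := fun z hz =>
    (hT.root_unique _ _ hz (hcls z) (hcls' z)).symm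
  have hcls_eq : ∀ a x, IsRoot T x → orderRel T a x → cls a = x := fun a x hx hax =>
    hT.root_unique _ _ (hcls a) hx (hT.equivalence.trans (hT.equivalence.symm (hcls' a)) hax)
  have hkid_root : ∀ S x y z, z ∈ kids S x y → ¬ IsRoot S z := fun S x y z hz hr =>
    hz.2.1 (hr _ hz.1)
  have hmem : ∀ z, ¬ IsRoot T z → z ∈ kids T (par z) (cls z) := fun z hz =>
    ⟨hpar z hz, hpar' z hz, hcls' z⟩
  have hpar_eq : ∀ x y z, z ∈ kids T x y → par z = x := fun x y z hz =>
    hT.parent_unique _ _ _ (hpar z (hkid_root _ _ _ _ hz)) hz.1 (hpar' z (hkid_root _ _ _ _ hz))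
      hz.2.1
  -- A non-root lies in exactly one set `kids T x y` with `x`, `y` roots: `x` is its parent and `y`
  -- the root of its class.
  let F : ℕ → ℕ := fun z => if IsRoot T z then h z else g (par z) (cls z) z
  have F_root : ∀ z, IsRoot T z → F z = h z := fun z hz => if_pos hz
  have F_kid : ∀ z, ¬ IsRoot T z → F z = g (par z) (cls z) z := fun z hz => if_neg hz
  have F_mem : ∀ z, ¬ IsRoot T z → F z ∈ kids T' (h (par z)) (h (cls z)) := fun z hz => by
    rw [F_kid z hz]
    exact gmaps _ _ (hparR z hz) (hcls z) (hmem z hz)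
  have F_isRoot : ∀ z, IsRoot T' (F z) ↔ IsRoot T z := fun z => by
    by_cases hz : IsRoot T z
    · simp only [hz, iff_true, F_root z hz]
      exact hmaps z hz
    · simp only [hz, iff_false]
      exact hkid_root _ _ _ _ (F_mem z hz)
  have F_cls : ∀ z, orderRel T' (F z) (h (cls z)) := fun z => by
    by_cases hz : IsRoot T z
    · rw [F_root z hz, hcls_root z hz]
      exact hT'.equivalence.refl _
    · exact (F_mem z hz).2.2
  -- Each class of `T'` has only one root and `h` is injective on roots, so `F` cannot merge two
  -- classes.
  have cls_of : ∀ a b, orderRel T' (F a) (F b) → cls a = cls b := fun a b hab =>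
    hinj _ _ (hcls a) (hcls b) (hT'.root_unique _ _ (hmaps _ (hcls a)) (hmaps _ (hcls b))
      (hT'.equivalence.trans (hT'.equivalence.symm (F_cls a)) (hT'.equivalence.trans hab (F_cls b))))
  have F_order : ∀ a b, orderRel T' (F a) (F b) ↔ orderRel T a b := fun a b => by
    constructor
    · intro hab
      have hc := cls_of a b hab
      exact hT.equivalence.trans (hcls' a) (hc ▸ hT.equivalence.symm (hcls' b))
    · intro hab
      have hc : cls a = cls b := hcls_eq a _ (hcls b) (hT.equivalence.trans hab (hcls' b))
      exact hT'.equivalence.trans (F_cls a) (hc ▸ hT'.equivalence.symm (F_cls b))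
  have par_of : ∀ a b, ¬ IsRoot T b → IsRoot T a → h a = h (par b) → a = par b :=
    fun a b hb ha hab => hinj _ _ ha (hparR b hb) hab
  have F_inj : F.Injective := fun a b hab => by
    have hr : IsRoot T a ↔ IsRoot T b := by rw [← F_isRoot a, ← F_isRoot b, hab]
    by_cases ha : IsRoot T a
    · have hb := hr.1 ha
      rw [F_root a ha, F_root b hb] at hab
      exact hinj a b ha hb hab
    · have hb : ¬ IsRoot T b := fun hb => ha (hr.2 hb)
      have hc : cls a = cls b := cls_of a b (hab ▸ hT'.equivalence.refl _)
      have h1 := F_mem a ha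
      have h2 := F_mem b hb
      rw [← hab] at h2
      have hp : par a = par b := hinj _ _ (hparR a ha) (hparR b hb)
        (hT'.parent_unique _ _ _ h1.1 h2.1 h1.2.1 h2.2.1)
      rw [F_kid a ha, F_kid b hb, ← hc, ← hp] at hab
      exact ginj _ _ (hparR a ha) (hcls a) (hmem a ha) (hp ▸ hc ▸ hmem b hb) hab
  refine ⟨F, F_inj, ?_, F_order, F_root, ?_⟩
  · intro a b
    by_cases hab : a = b
    · subst hab
      simp [hT.refl, hT'.refl]
    have hab' : F a ≠ F b := fun h => hab (F_inj h)
    by_cases hb : IsRoot T b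
    · exact iff_of_false (fun h => hab' ((F_isRoot b).2 hb _ h)) (fun h => hab (hb _ h))
    · have h1 := F_mem b hb
      constructor
      · intro hg
        have ha := (F_isRoot a).1 (hT'.isRoot_of_lt _ _ hg hab')
        have h2 := hT'.parent_unique _ _ _ hg h1.1 hab' h1.2.1
        rw [F_root a ha] at h2
        rw [par_of a b hb ha h2]
        exact hpar b hb
      · intro hg
        have ha : a = par b := hT.parent_unique _ _ _ hg (hpar b hb) hab (hpar' b hb)
        rw [F_root a (ha ▸ hparR b hb), ha]
        exact h1.1
  · intro x y hx hy z hz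
    rw [F_kid z (hkid_root _ _ _ _ hz), hpar_eq x y z hz, hcls_eq z y hy hz.2.2]

theorem exists_mapsTo_injOn_of_encard_le {s t : Set ℕ} (h : s.encard ≤ t.encard) :
    ∃ f : ℕ → ℕ, Set.MapsTo f s t ∧ Set.InjOn f s := by
  rcases s.finite_or_infinite with hs | hs
  · exact hs.exists_injOn_of_encard_le h
  · have ht : t.Infinite := Set.encard_eq_top_iff.1 (top_le_iff.1 (hs.encard_eq ▸ h))
    exact ⟨Nat.nth (· ∈ t), fun x _ => Nat.nth_mem_of_infinite ht x,
      (Nat.nth_injective ht).injOn⟩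

theorem exists_bijOn_of_encard_eq {s t : Set ℕ} (h : s.encard = t.encard) :
    ∃ f : ℕ → ℕ, Set.BijOn f s t := by
  classical
  rcases s.finite_or_infinite with hs | hs
  · exact hs.exists_bijOn_of_encard_eq h
  · have ht : t.Infinite := Set.encard_eq_top_iff.1 (h ▸ hs.encard_eq)
    -- The `n`-th element of `s` goes to the `n`-th element of `t`.
    refine ⟨fun x => Nat.nth (· ∈ t) (Nat.count (· ∈ s) x),
      fun x _ => Nat.nth_mem_of_infinite ht _, fun x hx y hy hxy => ?_, fun y hy => ?_⟩
    · exact Nat.count_injective hx hy (Nat.nth_injective ht hxy)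
    · refine ⟨Nat.nth (· ∈ s) (Nat.count (· ∈ t) y), Nat.nth_mem_of_infinite hs _, ?_⟩
      simp only
      rw [Nat.count_nth_of_infinite (p := (· ∈ s)) hs, Nat.nth_count (p := (· ∈ t)) hy]

theorem IsRootedForest.embedding {T T' : Mod ordGraph} (hT : IsRootedForest T)
    (hT' : IsRootedForest T') (h : ℕ → ℕ)
    (hmaps : ∀ x, IsRoot T x → IsRoot T' (h x))
    (hinj : ∀ x y, IsRoot T x → IsRoot T y → h x = h y → x = y)
    (hw : ∀ x y, IsRoot T x → IsRoot T y → weight T x y ≤ weight T' (h x) (h y)) :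
    Nonempty (@FirstOrder.Language.Embedding ordGraph ℕ ℕ T T') := by
  choose! g hg1 hg2 using fun x y hx hy => exists_mapsTo_injOn_of_encard_le (hw x y hx hy)
  obtain ⟨F, hF, h1, h2, -⟩ := hT.glue hT' h g hmaps hinj hg1 hg2
  exact embedding_of_rel F hF h1 h2

theorem IsRootedForest.equiv {T T' : Mod ordGraph} (hT : IsRootedForest T)
    (hT' : IsRootedForest T') (h : ℕ → ℕ) (hbij : Set.BijOn h {x | IsRoot T x} {x | IsRoot T' x})
    (hw : ∀ x y, IsRoot T x → IsRoot T y → weight T x y = weight T' (h x) (h y)) :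
    Nonempty (@FirstOrder.Language.Equiv ordGraph ℕ ℕ T T') := by
  choose! g hg using fun x y hx hy => exists_bijOn_of_encard_eq (hw x y hx hy)
  obtain ⟨F, hF, h1, h2, h3, h4⟩ := hT.glue hT' h g (fun x hx => hbij.mapsTo hx)
    (fun x y hx hy hxy => hbij.injOn hx hy hxy) (fun x y hx hy => (hg x y hx hy).mapsTo)
    (fun x y hx hy => (hg x y hx hy).injOn)
  refine equiv_of_rel F ⟨hF, fun z => ?_⟩ h1 h2
  by_cases hz : IsRoot T' z
  · obtain ⟨x, hx, rfl⟩ := hbij.surjOn hz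
    exact ⟨x, h3 x hx⟩
  · obtain ⟨p, hp, hp'⟩ := exists_parent hz
    obtain ⟨c, hc, hc'⟩ := hT'.exists_root z
    obtain ⟨x, hx, rfl⟩ := hbij.surjOn (hT'.isRoot_of_lt _ _ hp hp')
    obtain ⟨y, hy, rfl⟩ := hbij.surjOn hc
    obtain ⟨u, hu, rfl⟩ := (hg x y hx hy).surjOn ⟨hp, hp', hc'⟩
    exact ⟨u, h4 x y hx hy u hu⟩

end Trees

/-! ### Forests with prescribed weights -/

section ForestOfWeights

variable {R : Type} (ν : R ⊕ R × R × ℕ ≃ ℕ) (trash : R) (m : R → R → ℕ∞)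

open Classical in
/-- The class of a node: the root `i` lies in the class `i`, its child `(i, j, k)` lies in the
class `j` if `k < m i j`, and in the class of the fixed root `trash` otherwise. -/
noncomputable def nodeClass : R ⊕ R × R × ℕ → R
  | .inl i => i
  | .inr (i, j, k) => if (k : ℕ∞) < m i j then j else trash

/-- The rooted forest with set of roots `R` and weights `m`. -/
noncomputable abbrev forestOfWeights : Mod ordGraph where
  funMap := fun f _ => f.elim
  RelMap := fun {n} (r : OrdGraphRel n) => match r with
    | .graph => fun x => ν.symm (x 0) = ν.symm (x 1) ∨
        ∃ i j k, ν.symm (x 0) = .inl i ∧ ν.symm (x 1) = .inr (i, j, k)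
    | .order => fun x => nodeClass trash m (ν.symm (x 0)) = nodeClass trash m (ν.symm (x 1))

theorem orderRel_forestOfWeights (a b : ℕ) :
    orderRel (forestOfWeights ν trash m) a b ↔
      nodeClass trash m (ν.symm a) = nodeClass trash m (ν.symm b) := Iff.rfl

theorem isRoot_forestOfWeights (x : ℕ) :
    IsRoot (forestOfWeights ν trash m) x ↔ ∃ i, x = ν (.inl i) := by
  constructor
  · intro h
    rcases hx : ν.symm x with i | ⟨i, j, k⟩
    · exact ⟨i, by rw [← hx, ν.apply_symm_apply]⟩
    · have := h (ν (.inl i)) (Or.inr ⟨i, j, k, by simp, hx⟩)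
      rw [← this] at hx
      simp at hx
  · rintro ⟨i, rfl⟩ y hy
    rcases hy with hy | ⟨i', j, k, -, h⟩
    · exact ν.symm.injective hy
    · simp at h

theorem isRootedForest_forestOfWeights : IsRootedForest (forestOfWeights ν trash m) where
  refl a := Or.inl rfl
  isRoot_of_lt a b hab hne := by
    rcases hab with h | ⟨i, j, k, h, -⟩
    · exact absurd (ν.symm.injective h) hne
    · exact (isRoot_forestOfWeights ν trash m a).2 ⟨i, (ν.symm_apply_eq).1 h⟩
  parent_unique a b c ha hb hac hbc := by
    rcases ha with h | ⟨i, j, k, h1, h2⟩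
    · exact absurd (ν.symm.injective h) hac
    rcases hb with h | ⟨i', j', k', h1', h2'⟩
    · exact absurd (ν.symm.injective h) hbc
    have h3 := h2.symm.trans h2'
    simp only [Sum.inr.injEq, Prod.mk.injEq] at h3
    exact ν.symm.injective (h1.trans (h3.1 ▸ h1'.symm))
  equivalence := ⟨fun _ => rfl, fun h => h.symm, fun h h' => h.trans h'⟩
  exists_root z := by
    refine ⟨ν (.inl (nodeClass trash m (ν.symm z))), (isRoot_forestOfWeights ν trash m _).2
      ⟨_, rfl⟩, ?_⟩
    rw [orderRel_forestOfWeights]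
    simp [nodeClass]
  root_unique x y hx hy h := by
    obtain ⟨i, rfl⟩ := (isRoot_forestOfWeights ν trash m x).1 hx
    obtain ⟨j, rfl⟩ := (isRoot_forestOfWeights ν trash m y).1 hy
    rw [orderRel_forestOfWeights] at h
    simpa [nodeClass] using h

theorem encard_coe_lt (n : ℕ∞) : Set.encard {k : ℕ | (k : ℕ∞) < n} = n := by
  induction n using ENat.recTopCoe with
  | top =>
    have : {k : ℕ | (k : ℕ∞) < ⊤} = Set.univ := by ext; simp
    rw [this, Set.encard_eq_top_iff]
    exact Set.infinite_univ
  | coe n =>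
    have : {k : ℕ | (k : ℕ∞) < n} = (Finset.range n : Set ℕ) := by ext; simp
    rw [this, Set.encard_coe_eq_coe_finsetCard, Finset.card_range]

theorem mem_kids_forestOfWeights (i j : R) (z : ℕ) :
    z ∈ kids (forestOfWeights ν trash m) (ν (.inl i)) (ν (.inl j)) ↔
      ∃ j' k, z = ν (.inr (i, j', k)) ∧ nodeClass trash m (.inr (i, j', k)) = j := by
  constructor
  · rintro ⟨h1, h2, h3⟩
    rcases h1 with h | ⟨i', j', k, h, h'⟩
    · exact absurd (ν.symm.injective h) h2
    · obtain rfl : i = i' := by simpa using h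
      obtain rfl : z = ν (.inr (i, j', k)) := (ν.symm_apply_eq).1 h'
      rw [orderRel_forestOfWeights, ν.symm_apply_apply] at h3
      refine ⟨j', k, rfl, ?_⟩
      simpa [nodeClass] using h3
  · rintro ⟨j', k, rfl, h⟩
    refine ⟨Or.inr ⟨i, j', k, by simp, by simp⟩, by simp, ?_⟩
    rw [orderRel_forestOfWeights]
    simpa [nodeClass] using h

/-- The nodes do not depend on `m`, so `i` has surplus children `(i, j, k)` with `k ≥ m i j`. They
all go to the class of `trash`, where the weight is infinite anyway. -/
theorem weight_forestOfWeights (htrash : ∀ i, m i trash = ⊤) (i j : R) :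
    weight (forestOfWeights ν trash m) (ν (.inl i)) (ν (.inl j)) = m i j := by
  have hinj : Function.Injective fun k : ℕ => ν (.inr (i, j, k)) := fun k k' h => by
    simpa using h
  by_cases hj : j = trash
  · subst hj
    rw [htrash, weight, Set.encard_eq_top_iff]
    refine (Set.infinite_range_of_injective hinj).mono ?_
    rintro _ ⟨k, rfl⟩
    exact (mem_kids_forestOfWeights ν j m i j _).2 ⟨j, k, rfl, by simp [nodeClass]⟩
  · have : kids (forestOfWeights ν trash m) (ν (.inl i)) (ν (.inl j)) =
        (fun k : ℕ => ν (.inr (i, j, k))) '' {k : ℕ | (k : ℕ∞) < m i j} := by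
      ext z
      rw [mem_kids_forestOfWeights]
      constructor
      · rintro ⟨j', k, rfl, h⟩
        by_cases hk : (k : ℕ∞) < m i j'
        · obtain rfl : j' = j := by simpa [nodeClass, hk] using h
          exact ⟨k, hk, rfl⟩
        · exact absurd (by simpa [nodeClass, hk] using h.symm) hj
      · rintro ⟨k, hk, rfl⟩
        exact ⟨j, k, rfl, if_pos hk⟩
    rw [weight, this, hinj.encard_image, encard_coe_lt]

instance instCountableSymbolsOrdGraph : Countable ordGraph.Symbols := by
  let f : ordGraph.Symbols → Bool := fun x => match x with
    | .inl ⟨_, f⟩ => f.elim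
    | .inr ⟨_, .graph⟩ => true
    | .inr ⟨_, .order⟩ => false
  have hf : f.Injective := by
    rintro (⟨_, ⟨⟩⟩ | ⟨_, ⟨⟩⟩) (⟨_, ⟨⟩⟩ | ⟨_, ⟨⟩⟩) h <;> first | rfl | simp [f] at h
  exact hf.countable

/-- The tree order is constant in `m`, and the class of a node depends on at most one comparison `k
< m i j`. -/
theorem measurable_forestOfWeights [Countable R] {Y : Type*} [MeasurableSpace Y]
    {m : Y → R → R → ℕ∞} (hm : ∀ i j (k : ℕ), MeasurableSet {y | (k : ℕ∞) < m y i j}) :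
    Measurable fun y => forestOfWeights ν trash (m y) := by
  have hc : ∀ u i, MeasurableSet {y | nodeClass trash (m y) u = i} := by
    rintro (i' | ⟨i', j, k⟩) i
    · exact MeasurableSet.const (i' = i)
    · have : {y | nodeClass trash (m y) (.inr (i', j, k)) = i} =
          ({y | (k : ℕ∞) < m y i' j} ∩ {_y | j = i}) ∪
            ({y | (k : ℕ∞) < m y i' j}ᶜ ∩ {_y | trash = i}) := by
        ext y
        by_cases h : (k : ℕ∞) < m y i' j <;> simp [nodeClass, h]
      rw [this]
      exact ((hm _ _ _).inter (.const _)).union ((hm _ _ _).compl.inter (.const _))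
  refine measurable_to_mod ?_ fun k f => f.elim
  intro n r a
  cases r with
  | graph => exact MeasurableSet.const _
  | order =>
    have : {y | (forestOfWeights ν trash (m y)).RelMap (n := 2) OrdGraphRel.order a} =
        ⋃ i, {y | nodeClass trash (m y) (ν.symm (a 0)) = i} ∩
          {y | nodeClass trash (m y) (ν.symm (a 1)) = i} := by
      ext y
      simp only [Set.mem_iUnion, Set.mem_inter_iff]
      exact ⟨fun h => ⟨_, h, rfl⟩, fun ⟨_, h, h'⟩ => h.trans h'.symm⟩
    rw [this]
    exact MeasurableSet.iUnion fun i => (hc _ _).inter (hc _ _)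

end ForestOfWeights

/-! ### Coding families of relations by weights -/

section Codes

variable {S : Type} {ar : S → ℕ}

/-- Families of relations on `ω` of arities `ar`. -/
abbrev RelFamily (ar : S → ℕ) := ∀ σ, (Fin (ar σ) → ℕ) → Prop

/-- The roots of the forest coding a family of relations: elements, atomic statements about them,
and the members of an infinite set on which all weights are infinite. -/
inductive CodeNode (ar : S → ℕ) : Type
  | elt (a : ℕ) : CodeNode ar
  | atom (σ : S) (s : Fin (ar σ) → ℕ) : CodeNode ar
  | ker (k : ℕ) : CodeNode ar

instance instCountableCodeNode [Countable S] : Countable (CodeNode ar) := by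
  let f : CodeNode ar → ℕ ⊕ (Σ σ, Fin (ar σ) → ℕ) ⊕ ℕ := fun x => match x with
    | .elt a => .inl a
    | .atom σ s => .inr (.inl ⟨σ, s⟩)
    | .ker k => .inr (.inr k)
  have hf : f.Injective := by
    rintro (a | ⟨σ, s⟩ | k) (a' | ⟨σ', s'⟩ | k') h <;> simp [f] at h
    · rw [h]
    · obtain ⟨rfl, h⟩ := h
      rw [eq_of_heq h]
    · rw [h]
  exact hf.countable

theorem CodeNode.elt_injective : Function.Injective (CodeNode.elt (ar := ar)) :=
  fun _ _ h => by cases h; rfl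

theorem CodeNode.ker_injective : Function.Injective (CodeNode.ker (ar := ar)) :=
  fun _ _ h => by cases h; rfl

/-- The action of a permutation of the elements on the roots. -/
def CodeNode.map (h : ℕ → ℕ) : CodeNode ar → CodeNode ar
  | .elt a => .elt (h a)
  | .atom σ s => .atom σ (h ∘ s)
  | .ker k => .ker k

theorem CodeNode.map_map (h g : ℕ → ℕ) (x : CodeNode ar) : (x.map g).map h = x.map (h ∘ g) := by
  cases x <;> rfl

theorem CodeNode.map_id (x : CodeNode ar) : x.map id = x := by
  cases x <;> rfl

/-- A code for the set of positions at which `a` occurs in the tuple `s`. -/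
def fiberCode {k : ℕ} (s : Fin k → ℕ) (a : ℕ) : ℕ :=
  Encodable.encode (Finset.univ.filter fun i => s i = a)

theorem fiberCode_eq_iff {k : ℕ} {s t : Fin k → ℕ} {a b : ℕ} :
    fiberCode s a = fiberCode t b ↔ ∀ i, s i = a ↔ t i = b := by
  simp [fiberCode, Finset.ext_iff]

variable [Encodable S]

open Classical in
/-- A code for a symbol and a truth value. -/
noncomputable def truthCode (σ : S) (p : Prop) : ℕ :=
  -- The leading `1` keeps the code nonzero, the factor `2` leaves room for the truth value.
  1 + 2 * Encodable.encode σ + if p then 1 else 0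

theorem truthCode_eq_iff {σ τ : S} {p q : Prop} :
    truthCode σ p = truthCode τ q ↔ σ = τ ∧ (p ↔ q) := by
  unfold truthCode
  constructor
  · intro h
    constructor
    · apply Encodable.encode_injective
      split_ifs at h <;> omega
    · split_ifs at h with h1 h2 h2
      · tauto
      · omega
      · omega
      · tauto
  · rintro ⟨rfl, h⟩
    rw [propext h]

open Classical in
/-- The weights coding a family of relations. -/
noncomputable def codeWeight (P : RelFamily ar) : CodeNode ar → CodeNode ar → ℕ∞
  -- Self-weights separate the three kinds of roots: zero for elements, positive and finite for
  -- atoms, infinite for the kernel. The weights from an atom to the elements determine its tuple.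
  | .elt _, .elt _ => 0
  | .elt _, .atom _ _ => 0
  | .elt _, .ker _ => ⊤
  | .atom _ s, .elt a => (fiberCode s a : ℕ)
  | .atom σ s, .atom τ t =>
      if (⟨σ, s⟩ : Σ σ, Fin (ar σ) → ℕ) = ⟨τ, t⟩ then (truthCode σ (P σ s) : ℕ) else 0
  | .atom _ _, .ker _ => ⊤
  | .ker _, .elt _ => 0
  | .ker _, .atom _ _ => 0
  | .ker _, .ker _ => ⊤

@[simp] theorem codeWeight_atom_self (P : RelFamily ar) (σ : S) (s : Fin (ar σ) → ℕ) :
    codeWeight P (.atom σ s) (.atom σ s) = (truthCode σ (P σ s) : ℕ) := by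
  simp [codeWeight]

theorem codeWeight_ker (P : RelFamily ar) (x : CodeNode ar) (k : ℕ) :
    codeWeight P x (.ker k) = ⊤ := by
  cases x <;> rfl

theorem truthCode_ne_zero (σ : S) (p : Prop) : truthCode σ p ≠ 0 := by
  unfold truthCode; omega

theorem codeWeight_self_eq_zero {P : RelFamily ar} {x : CodeNode ar} :
    codeWeight P x x = 0 ↔ ∃ a, x = .elt a := by
  rcases x with a | ⟨σ, s⟩ | k
  · simp [codeWeight]
  · simp [truthCode_ne_zero]
  · simp [codeWeight]

theorem codeWeight_self_eq_top {P : RelFamily ar} {x : CodeNode ar} :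
    codeWeight P x x = ⊤ ↔ ∃ k, x = .ker k := by
  rcases x with a | ⟨σ, s⟩ | k <;> simp [codeWeight]

theorem codeWeight_self_eq_truthCode {P : RelFamily ar} {x : CodeNode ar} {σ : S} {p : Prop} :
    codeWeight P x x = (truthCode σ p : ℕ) ↔ ∃ s, x = .atom σ s ∧ (P σ s ↔ p) := by
  rcases x with a | ⟨τ, s⟩ | k
  · refine iff_of_false (fun h => truthCode_ne_zero σ p ?_) (by simp)
    exact Nat.cast_injective (R := ℕ∞) (by simpa [codeWeight] using h.symm)
  · simp only [codeWeight_atom_self, Nat.cast_inj, truthCode_eq_iff, CodeNode.atom.injEq]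
    constructor
    · rintro ⟨rfl, h⟩
      exact ⟨s, ⟨rfl, HEq.rfl⟩, h⟩
    · rintro ⟨t, ⟨rfl, h⟩, h'⟩
      cases h
      exact ⟨rfl, h'⟩
  · simp [codeWeight]

/-- `T` codes the family of relations `P`. -/
def IsCode (P : RelFamily ar) (T : Mod ordGraph) : Prop :=
  IsRootedForest T ∧ ∃ e : CodeNode ar → ℕ, e.Injective ∧ Set.range e = {x | IsRoot T x} ∧
    ∀ x y, weight T (e x) (e y) = codeWeight P x y

/-- Isomorphism of families of relations. -/
def RelFamily.Iso (P P' : RelFamily ar) : Prop :=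
  ∃ h : ℕ ≃ ℕ, ∀ σ s, P σ s ↔ P' σ (h ∘ s)

theorem codeWeight_map {P P' : RelFamily ar} {h : ℕ ≃ ℕ} (hP : ∀ σ s, P σ s ↔ P' σ (h ∘ s))
    (x y : CodeNode ar) : codeWeight P' (x.map h) (y.map h) = codeWeight P x y := by
  rcases x with a | ⟨σ, s⟩ | k <;> rcases y with b | ⟨τ, t⟩ | l <;> try rfl
  · simp only [CodeNode.map, codeWeight, Nat.cast_inj, fiberCode_eq_iff]
    simp
  · by_cases heq : (⟨σ, s⟩ : Σ σ, Fin (ar σ) → ℕ) = ⟨τ, t⟩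
    · cases heq
      simp only [CodeNode.map, codeWeight_atom_self, Nat.cast_inj, truthCode_eq_iff, true_and]
      exact (hP σ s).symm
    · have : (⟨σ, h ∘ s⟩ : Σ σ, Fin (ar σ) → ℕ) ≠ ⟨τ, h ∘ t⟩ := fun h' => heq (by
        simp only [Sigma.mk.injEq] at h'
        obtain ⟨rfl, h'⟩ := h'
        rw [h.injective.comp_left (eq_of_heq h')])
      simp only [CodeNode.map, codeWeight, if_neg this, if_neg heq]

/-- An isomorphism `h` of families acts on the roots by `CodeNode.map h`, which preserves weights.
-/
theorem IsCode.equiv {P P' : RelFamily ar} {T T' : Mod ordGraph} (hT : IsCode P T)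
    (hT' : IsCode P' T') (hP : P.Iso P') :
    Nonempty (@FirstOrder.Language.Equiv ordGraph ℕ ℕ T T') := by
  obtain ⟨hf, e, he, her, hew⟩ := hT
  obtain ⟨hf', e', he', her', hew'⟩ := hT'
  obtain ⟨h, hh⟩ := hP
  have : Nonempty (CodeNode ar) := ⟨.elt 0⟩
  have hroot : ∀ x, IsRoot T x ↔ ∃ i, e i = x := fun x => (Set.ext_iff.1 her x).symm
  have hroot' : ∀ x, IsRoot T' x ↔ ∃ i, e' i = x := fun x => (Set.ext_iff.1 her' x).symm
  have hinv : ∀ i, Function.invFun e (e i) = i := Function.leftInverse_invFun he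
  refine hf.equiv hf' (fun x => e' ((Function.invFun e x).map h)) ⟨?_, ?_, ?_⟩ ?_
  · intro x _
    exact (hroot' _).2 ⟨_, rfl⟩
  · intro x hx y hy hxy
    obtain ⟨i, rfl⟩ := (hroot x).1 hx
    obtain ⟨j, rfl⟩ := (hroot y).1 hy
    have := congrArg (CodeNode.map h.symm) (he' hxy)
    simp only [hinv, CodeNode.map_map, Equiv.symm_comp_self, CodeNode.map_id] at this
    rw [this]
  · intro y hy
    obtain ⟨j, rfl⟩ := (hroot' y).1 hy
    refine ⟨e (j.map h.symm), (hroot _).2 ⟨_, rfl⟩, ?_⟩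
    simp only [hinv, CodeNode.map_map, Equiv.self_comp_symm, CodeNode.map_id]
  · intro x y hx hy
    obtain ⟨i, rfl⟩ := (hroot x).1 hx
    obtain ⟨j, rfl⟩ := (hroot y).1 hy
    simp only [hinv, hew, hew', codeWeight_map hh]

/-- The root `x` of `T` is sent to the `x`-th kernel root of `T'`. All weights there are infinite,
so none can decrease. -/
theorem IsCode.embedding {P P' : RelFamily ar} {T T' : Mod ordGraph} (hT : IsCode P T)
    (hT' : IsCode P' T') : Nonempty (@FirstOrder.Language.Embedding ordGraph ℕ ℕ T T') := by
  obtain ⟨hf, -⟩ := hT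
  obtain ⟨hf', e', he', her', hew'⟩ := hT'
  refine hf.embedding hf' (fun x => e' (.ker x)) ?_ ?_ ?_
  · exact fun x _ => (Set.ext_iff.1 her' _).1 ⟨_, rfl⟩
  · exact fun x y _ _ h => CodeNode.ker_injective (he' h)
  · intro x y _ _
    rw [hew', codeWeight_ker]
    exact le_top

theorem IsRootedForest.of_rel {T T' : Mod ordGraph} (hf : IsRootedForest T) (φ : ℕ ≃ ℕ)
    (hg : ∀ a b, graphRel T' (φ a) (φ b) ↔ graphRel T a b)
    (ho : ∀ a b, orderRel T' (φ a) (φ b) ↔ orderRel T a b)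
    (hr : ∀ x, IsRoot T' (φ x) ↔ IsRoot T x) : IsRootedForest T' where
  refl := φ.surjective.forall.2 fun a => (hg a a).2 (hf.refl a)
  isRoot_of_lt := φ.surjective.forall₂.2 fun a b h hne =>
    (hr a).2 (hf.isRoot_of_lt a b ((hg a b).1 h) fun h => hne (congrArg φ h))
  parent_unique := φ.surjective.forall₃.2 fun a b c hac hbc h h' =>
    congrArg φ (hf.parent_unique a b c ((hg _ _).1 hac) ((hg _ _).1 hbc)
      (fun h'' => h (congrArg φ h'')) fun h'' => h' (congrArg φ h''))
  equivalence :=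
    { refl := φ.surjective.forall.2 fun a => (ho a a).2 (hf.equivalence.refl a)
      symm := fun {a b} => by
        obtain ⟨a, rfl⟩ := φ.surjective a
        obtain ⟨b, rfl⟩ := φ.surjective b
        rw [ho, ho]
        exact hf.equivalence.symm
      trans := fun {a b c} => by
        obtain ⟨a, rfl⟩ := φ.surjective a
        obtain ⟨b, rfl⟩ := φ.surjective b
        obtain ⟨c, rfl⟩ := φ.surjective c
        rw [ho, ho, ho]
        exact hf.equivalence.trans }
  exists_root := φ.surjective.forall.2 fun z => by
    obtain ⟨x, hx, hzx⟩ := hf.exists_root z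
    exact ⟨φ x, (hr x).2 hx, (ho z x).2 hzx⟩
  root_unique := φ.surjective.forall₂.2 fun x y hx hy h =>
    congrArg φ (hf.root_unique x y ((hr x).1 hx) ((hr y).1 hy) ((ho x y).1 h))

theorem rel_of_equiv {T T' : Mod ordGraph}
    (h : Nonempty (@FirstOrder.Language.Equiv ordGraph ℕ ℕ T T')) :
    ∃ φ : ℕ ≃ ℕ, (∀ a b, graphRel T' (φ a) (φ b) ↔ graphRel T a b) ∧
      ∀ a b, orderRel T' (φ a) (φ b) ↔ orderRel T a b := by
  obtain ⟨F⟩ := h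
  let φ : ℕ ≃ ℕ := @FirstOrder.Language.Equiv.toEquiv ordGraph ℕ ℕ T T' F
  have hx : ∀ a b, ![φ a, φ b] = φ ∘ ![a, b] := fun a b => by funext i; fin_cases i <;> rfl
  refine ⟨φ, fun a b => ?_, fun a b => ?_⟩
  · unfold graphRel
    rw [hx]
    exact @FirstOrder.Language.Equiv.map_rel' ordGraph ℕ ℕ T T' F 2 OrdGraphRel.graph ![a, b]
  · unfold orderRel
    rw [hx]
    exact @FirstOrder.Language.Equiv.map_rel' ordGraph ℕ ℕ T T' F 2 OrdGraphRel.order ![a, b]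

theorem IsCode.of_equiv {P : RelFamily ar} {T T' : Mod ordGraph} (hT : IsCode P T)
    (hTT' : Nonempty (@FirstOrder.Language.Equiv ordGraph ℕ ℕ T T')) : IsCode P T' := by
  obtain ⟨φ, hg, ho⟩ := rel_of_equiv hTT'
  have hr : ∀ x, IsRoot T' (φ x) ↔ IsRoot T x := fun x =>
    φ.surjective.forall.trans (forall_congr' fun y =>
      imp_congr (hg y x) φ.injective.eq_iff)
  have hk : ∀ x y, kids T' (φ x) (φ y) = φ '' kids T x y := fun x y => by
    ext z
    obtain ⟨z, rfl⟩ := φ.surjective z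
    simp [kids, hg, ho]
  obtain ⟨hf, e, he, her, hew⟩ := hT
  refine ⟨hf.of_rel φ hg ho hr, φ ∘ e, φ.injective.comp he, ?_, fun x y => ?_⟩
  · rw [Set.range_comp, her]
    ext z
    obtain ⟨z, rfl⟩ := φ.surjective z
    simp [hr]
  · rw [← hew]
    unfold weight
    simp only [Function.comp_apply, hk, φ.injective.encard_image]

/-- Comparing the two labellings of the roots gives a weight-preserving permutation `f` of `CodeNode
ar`. Self-weight zero makes it permute the elements, by some `h`; on atoms, self-weights preserve
symbol and truth value. -/
theorem IsCode.iso {P P' : RelFamily ar} {T : Mod ordGraph} (hT : IsCode P T)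
    (hT' : IsCode P' T) : P.Iso P' := by
  obtain ⟨-, e, he, her, hew⟩ := hT
  obtain ⟨-, e', he', her', hew'⟩ := hT'
  choose f hf using fun x => (her.trans her'.symm).subset ⟨x, rfl⟩
  choose g hg using fun x => (her'.trans her.symm).subset ⟨x, rfl⟩
  have hfw : ∀ x y, codeWeight P' (f x) (f y) = codeWeight P x y := fun x y => by
    rw [← hew', hf, hf, hew]
  have hgw : ∀ x y, codeWeight P (g x) (g y) = codeWeight P' x y := fun x y => by
    rw [← hew, hg, hg, hew']
  have hfg : ∀ x, f (g x) = x := fun x => he' (by rw [hf, hg])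
  have hgf : ∀ x, g (f x) = x := fun x => he (by rw [hg, hf])
  choose h hh using fun a => codeWeight_self_eq_zero.1 ((hfw (.elt a) (.elt a)).trans rfl)
  choose k hk using fun a => codeWeight_self_eq_zero.1 ((hgw (.elt a) (.elt a)).trans rfl)
  refine ⟨⟨h, k, fun a => CodeNode.elt_injective (ar := ar) ?_,
    fun a => CodeNode.elt_injective (ar := ar) ?_⟩, fun σ s => ?_⟩
  · rw [← hk, ← hh, hgf]
  · rw [← hh, ← hk, hfg]
  · have h1 := hfw (.atom σ s) (.atom σ s)
    rw [codeWeight_atom_self] at h1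
    obtain ⟨t, ht, htP⟩ := codeWeight_self_eq_truthCode.1 h1
    -- Position `i` of `s` holds `s i`; equality of fiber codes forces position `i` of `t` to hold
    -- `h (s i)`.
    have : t = h ∘ s := by
      funext i
      have h2 := hfw (.atom σ s) (.elt (s i))
      rw [ht, hh] at h2
      simp only [codeWeight, Nat.cast_inj, fiberCode_eq_iff] at h2
      exact (h2 i).2 rfl
    rw [← htP, this]
    rfl

/-- The numbering `ν` of the nodes is the same for all `P`. Only the self-weights of atoms depend on
`P`, each on a single truth value, hence the measurability. -/
theorem exists_codeForest (ar : S → ℕ) : ∃ F : RelFamily ar → Mod ordGraph,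
    (∀ P, IsCode P (F P)) ∧
    ∀ {Y : Type} [MeasurableSpace Y] (P : Y → RelFamily ar),
      (∀ σ s, MeasurableSet {y | P y σ s}) → Measurable fun y => F (P y) := by
  have : Infinite (CodeNode ar) := Infinite.of_injective _ CodeNode.elt_injective
  obtain ⟨ν⟩ : Nonempty (CodeNode ar ⊕ CodeNode ar × CodeNode ar × ℕ ≃ ℕ) :=
    nonempty_equiv_of_countable
  refine ⟨fun P => forestOfWeights ν (.ker 0) (codeWeight P), fun P => ?_, fun P hP => ?_⟩
  · refine ⟨isRootedForest_forestOfWeights _ _ _, fun i => ν (.inl i),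
      fun i j h => by simpa using h, ?_, weight_forestOfWeights _ _ _ (codeWeight_ker P · 0)⟩
    ext x
    simp [isRoot_forestOfWeights, eq_comm]
  · refine measurable_forestOfWeights ν _ fun i j k => ?_
    rcases i with a | ⟨σ, s⟩ | l
    · cases j <;> simp only [codeWeight] <;> exact MeasurableSet.const _
    swap
    · cases j <;> simp only [codeWeight] <;> exact MeasurableSet.const _
    rcases j with b | ⟨τ, t⟩ | l
    · simp only [codeWeight]
      exact MeasurableSet.const _
    swap
    · simp only [codeWeight]
      exact MeasurableSet.const _
    by_cases heq : (⟨σ, s⟩ : Σ σ, Fin (ar σ) → ℕ) = ⟨τ, t⟩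
    · cases heq
      have : {y | (k : ℕ∞) < codeWeight (P y) (.atom σ s) (.atom σ s)} =
          ({y | P y σ s} ∩ {_y | k < truthCode σ True}) ∪
            ({y | P y σ s}ᶜ ∩ {_y | k < truthCode σ False}) := by
        ext y
        by_cases h : P y σ s <;> simp [h]
      rw [this]
      exact ((hP _ _).inter (.const _)).union ((hP _ _).compl.inter (.const _))
    · simp only [codeWeight, if_neg heq]
      exact MeasurableSet.const _

end Codes

/-! ### Axioms for codes, and decoding -/

section CodeForests

variable {S : Type} [Encodable S] {ar : S → ℕ}

/-- `x` codes an element. -/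
def IsElt (T : Mod ordGraph) (x : ℕ) : Prop := IsRoot T x ∧ weight T x x = 0

/-- `x` belongs to the set of roots on which all weights are infinite. -/
def IsKer (T : Mod ordGraph) (x : ℕ) : Prop := IsRoot T x ∧ weight T x x = ⊤

/-- `p` codes the atomic statement that `σ` holds of `s`, with the truth value `b`. -/
def IsAtom (T : Mod ordGraph) (p : ℕ) (σ : S) (s : Fin (ar σ) → ℕ) (b : Bool) : Prop :=
  IsRoot T p ∧ weight T p p = (truthCode σ (b = true) : ℕ) ∧
    ∀ a, IsElt T a → weight T p a = (fiberCode s a : ℕ)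

/-- The axioms of the forests that code a family of relations. -/
structure IsCodeForest (ar : S → ℕ) (T : Mod ordGraph) : Prop where
  forest : IsRootedForest T
  encard_elt : {x | IsElt T x}.encard = ⊤
  encard_ker : {x | IsKer T x}.encard = ⊤
  exists_atom : ∀ σ, ∀ s : Fin (ar σ) → ℕ, (∀ i, IsElt T (s i)) → ∃ p, ∃ b, IsAtom T p σ s b
  -- As `b` and `c` may differ, this also excludes opposite truth values: `p = q` has only one
  -- self-weight.
  atom_unique : ∀ σ, ∀ s : Fin (ar σ) → ℕ, (∀ i, IsElt T (s i)) → ∀ b c, ∀ p q,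
    IsAtom T p σ s b → IsAtom T q σ s c → p = q
  root_cases : ∀ p, IsRoot T p → IsElt T p ∨ IsKer T p ∨
    ∃ σ, ∃ s : Fin (ar σ) → ℕ, (∀ i, IsElt T (s i)) ∧ ∃ b, IsAtom T p σ s b
  weight_ker : ∀ x y, IsRoot T x → IsKer T y → weight T x y = ⊤
  -- The disjunction below leaves out only the weights from atoms to elements, which `IsAtom`
  -- prescribes.
  weight_zero : ∀ x y, IsRoot T x → IsRoot T y → ¬ IsKer T y → x ≠ y →
    (IsElt T x ∨ IsKer T x ∨ ¬ IsElt T y) → weight T x y = 0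

/-- The enumeration of the elements coded by `T`. -/
noncomputable def eltEnum (T : Mod ordGraph) : ℕ → ℕ := Nat.nth (IsElt T)

/-- `σ` holds of the coded elements `s`. -/
def Holds (T : Mod ordGraph) (σ : S) (s : Fin (ar σ) → ℕ) : Prop := ∃ p, IsAtom T p σ s true

/-- The family of relations coded by `T`. -/
def decode (ar : S → ℕ) (T : Mod ordGraph) : RelFamily ar := fun σ s => Holds T σ (eltEnum T ∘ s)

namespace IsCodeForest

variable {T : Mod ordGraph}

theorem infinite_elt (hT : IsCodeForest ar T) : {x | IsElt T x}.Infinite :=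
  Set.encard_eq_top_iff.1 hT.encard_elt

theorem isElt_eltEnum (hT : IsCodeForest ar T) (a : ℕ) : IsElt T (eltEnum T a) :=
  Nat.nth_mem_of_infinite hT.infinite_elt a

theorem eltEnum_injective (hT : IsCodeForest ar T) : Function.Injective (eltEnum T) :=
  Nat.nth_injective hT.infinite_elt

theorem exists_eltEnum (hT : IsCodeForest ar T) {x : ℕ} (hx : IsElt T x) : ∃ a, eltEnum T a = x :=
  (Set.ext_iff.1 (Nat.range_nth_of_infinite hT.infinite_elt) x).2 hx

/-- The labelling enumerates elements and kernel increasingly and picks for each atom the root given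
by `exists_atom`; the axioms make it a bijection onto the roots with the right weights. -/
theorem isCode_decode (hT : IsCodeForest ar T) : IsCode (decode ar T) T := by
  have hker : {x | IsKer T x}.Infinite := Set.encard_eq_top_iff.1 hT.encard_ker
  have hk : ∀ k, IsKer T (Nat.nth (IsKer T) k) := Nat.nth_mem_of_infinite hker
  choose p b hp using fun σ (s : Fin (ar σ) → ℕ) =>
    hT.exists_atom σ (eltEnum T ∘ s) fun i => hT.isElt_eltEnum (s i)
  have hpP : ∀ σ s, decode ar T σ s ↔ b σ s = true := fun σ s => by
    constructor
    · rintro ⟨q, hq⟩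
      have hqp := hT.atom_unique σ _ (fun i => hT.isElt_eltEnum (s i)) _ _ q _ hq (hp σ s)
      subst hqp
      have h := hq.2.1.symm.trans (hp σ s).2.1
      rw [Nat.cast_inj, truthCode_eq_iff] at h
      exact h.2.1 rfl
    · intro h
      exact ⟨_, h ▸ hp σ s⟩
  let e : CodeNode ar → ℕ := fun x => match x with
    | .elt a => eltEnum T a
    | .atom σ s => p σ s
    | .ker k => Nat.nth (IsKer T) k
  have heroot : ∀ x, IsRoot T (e x) := by
    rintro (a | ⟨σ, s⟩ | k)
    · exact (hT.isElt_eltEnum a).1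
    · exact (hp σ s).1
    · exact (hk k).1
  have hdiag : ∀ x, weight T (e x) (e x) = codeWeight (decode ar T) x x := by
    rintro (a | ⟨σ, s⟩ | k)
    · exact (hT.isElt_eltEnum a).2
    · rw [codeWeight_atom_self, propext (hpP σ s)]
      exact (hp σ s).2.1
    · exact (hk k).2
  have hpelt : ∀ σ s a, weight T (p σ s) (eltEnum T a) = (fiberCode s a : ℕ) := fun σ s a => by
    rw [(hp σ s).2.2 _ (hT.isElt_eltEnum a), Nat.cast_inj, fiberCode_eq_iff]
    exact fun i => hT.eltEnum_injective.eq_iff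
  -- Self-weights determine the kind of a root and the symbol of an atom; fiber codes then determine
  -- the tuple.
  have he : e.Injective := by
    intro x y hxy
    have hd : codeWeight (decode ar T) x x = codeWeight (decode ar T) y y := by
      rw [← hdiag, ← hdiag, hxy]
    rcases y with a | ⟨σ, s⟩ | k
    · obtain ⟨a', rfl⟩ := codeWeight_self_eq_zero.1 hd
      rw [hT.eltEnum_injective hxy]
    · rw [codeWeight_atom_self] at hd
      obtain ⟨t, rfl, -⟩ := codeWeight_self_eq_truthCode.1 hd
      have hxy' : p σ t = p σ s := hxy
      congr 1
      funext i
      have := hpelt σ t (t i)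
      rw [hxy', hpelt, Nat.cast_inj, fiberCode_eq_iff] at this
      exact ((this i).2 rfl).symm
    · obtain ⟨k', rfl⟩ := codeWeight_self_eq_top.1 hd
      rw [Nat.nth_injective hker hxy]
  have hnker : ∀ x, codeWeight (decode ar T) x x ≠ ⊤ → ¬ IsKer T (e x) := fun x hx h =>
    hx ((hdiag x).symm.trans h.2)
  have hnelt : ∀ x, codeWeight (decode ar T) x x ≠ 0 → ¬ IsElt T (e x) := fun x hx h =>
    hx ((hdiag x).symm.trans h.2)
  refine ⟨hT.forest, e, he, ?_, fun x y => ?_⟩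
  · ext x
    constructor
    · rintro ⟨i, rfl⟩
      exact heroot i
    · intro hx
      rcases hT.root_cases x hx with h | h | ⟨σ, s, hs, c, hc⟩
      · obtain ⟨a, rfl⟩ := hT.exists_eltEnum h
        exact ⟨.elt a, rfl⟩
      · obtain ⟨k, rfl⟩ := (Set.ext_iff.1 (Nat.range_nth_of_infinite hker) x).2 h
        exact ⟨.ker k, rfl⟩
      · choose t ht using fun i => hT.exists_eltEnum (hs i)
        obtain rfl : eltEnum T ∘ t = s := funext ht
        exact ⟨.atom σ t, hT.atom_unique σ _ hs _ _ _ _ (hp σ t) hc⟩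
  · by_cases hxy : x = y
    · subst hxy
      exact hdiag x
    have hne : e x ≠ e y := fun h => hxy (he h)
    rcases y with a | ⟨τ, t⟩ | l
    · have h := hT.weight_zero _ _ (heroot x) (heroot (.elt a))
        (hnker (.elt a) (by simp [codeWeight])) hne
      rcases x with a' | ⟨σ, s⟩ | k
      · exact h (Or.inl (hT.isElt_eltEnum a'))
      · exact hpelt σ s a
      · exact h (Or.inr (Or.inl (hk k)))
    · have h := hT.weight_zero _ _ (heroot x) (heroot (.atom τ t))
        (hnker (.atom τ t) (by simp)) hne
        (Or.inr (Or.inr (hnelt (.atom τ t) (by simp [truthCode_ne_zero]))))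
      rw [h]
      rcases x with a' | ⟨σ, s⟩ | k
      · rfl
      · have : (⟨σ, s⟩ : Σ σ, Fin (ar σ) → ℕ) ≠ ⟨τ, t⟩ := fun h' => by
          cases h'
          exact hxy rfl
        simp only [codeWeight, if_neg this]
      · rfl
    · rw [codeWeight_ker]
      exact hT.weight_ker _ _ (heroot x) (hk l)

end IsCodeForest

/-- With `IsCodeForest.isCode_decode` this shows that the axioms capture exactly the forests coding
some family. -/
theorem IsCode.isCodeForest {P : RelFamily ar} {T : Mod ordGraph} (hT : IsCode P T) :
    IsCodeForest ar T := by
  obtain ⟨hf, e, he, her, hew⟩ := hT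
  have hroot : ∀ x, IsRoot T x ↔ ∃ i, e i = x := fun x => (Set.ext_iff.1 her x).symm
  have heroot : ∀ i, IsRoot T (e i) := fun i => (hroot _).2 ⟨i, rfl⟩
  have helt' : ∀ x, IsElt T x ↔ ∃ a, e (.elt a) = x := fun x => by
    constructor
    · rintro ⟨h, h'⟩
      obtain ⟨i, rfl⟩ := (hroot x).1 h
      rw [hew] at h'
      obtain ⟨a, rfl⟩ := codeWeight_self_eq_zero.1 h'
      exact ⟨a, rfl⟩
    · rintro ⟨a, rfl⟩
      exact ⟨heroot _, hew _ _⟩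
  have hker' : ∀ x, IsKer T x ↔ ∃ k, e (.ker k) = x := fun x => by
    constructor
    · rintro ⟨h, h'⟩
      obtain ⟨i, rfl⟩ := (hroot x).1 h
      rw [hew] at h'
      obtain ⟨a, rfl⟩ := codeWeight_self_eq_top.1 h'
      exact ⟨a, rfl⟩
    · rintro ⟨a, rfl⟩
      exact ⟨heroot _, hew _ _⟩
  have hlift : ∀ σ (s : Fin (ar σ) → ℕ), (∀ i, IsElt T (s i)) →
      ∃ t : Fin (ar σ) → ℕ, s = fun i => e (.elt (t i)) := fun σ s hs => by
    choose t ht using fun i => (helt' _).1 (hs i)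
    exact ⟨t, funext fun i => (ht i).symm⟩
  have hatom : ∀ q σ (t : Fin (ar σ) → ℕ) (b : Bool), IsAtom T q σ (fun i => e (.elt (t i))) b ↔
      q = e (.atom σ t) ∧ (P σ t ↔ b = true) := fun q σ t b => by
    have hfib : ∀ a, fiberCode (fun i => e (.elt (t i))) (e (.elt a)) = fiberCode t a := fun a => by
      rw [fiberCode_eq_iff]
      exact fun i => (he.comp CodeNode.elt_injective).eq_iff
    constructor
    · rintro ⟨h1, h2, h3⟩
      obtain ⟨x, rfl⟩ := (hroot q).1 h1
      rw [hew] at h2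
      obtain ⟨s, rfl, hs⟩ := codeWeight_self_eq_truthCode.1 h2
      have : s = t := funext fun i => by
        have h := h3 _ ((helt' _).2 ⟨s i, rfl⟩)
        rw [hew, hfib] at h
        simp only [codeWeight, Nat.cast_inj, fiberCode_eq_iff] at h
        exact ((h i).1 rfl).symm
      subst this
      exact ⟨rfl, hs⟩
    · rintro ⟨rfl, h⟩
      refine ⟨heroot _, ?_, ?_⟩
      · rw [hew, codeWeight_self_eq_truthCode]
        exact ⟨t, rfl, h⟩
      · intro a ha
        obtain ⟨a, rfl⟩ := (helt' _).1 ha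
        rw [hew, hfib]
        rfl
  refine ⟨hf, ?_, ?_, ?_, ?_, ?_, ?_, ?_⟩
  · rw [Set.encard_eq_top_iff]
    refine (Set.infinite_range_of_injective (he.comp CodeNode.elt_injective)).mono ?_
    rintro _ ⟨a, rfl⟩
    exact (helt' _).2 ⟨a, rfl⟩
  · rw [Set.encard_eq_top_iff]
    refine (Set.infinite_range_of_injective (he.comp CodeNode.ker_injective)).mono ?_
    rintro _ ⟨a, rfl⟩
    exact (hker' _).2 ⟨a, rfl⟩
  · intro σ s hs
    obtain ⟨t, rfl⟩ := hlift σ s hs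
    classical
    exact ⟨e (.atom σ t), decide (P σ t), (hatom _ _ _ _).2 ⟨rfl, by simp⟩⟩
  · intro σ s hs b c p q hp hq
    obtain ⟨t, rfl⟩ := hlift σ s hs
    rw [hatom] at hp hq
    rw [hp.1, hq.1]
  · intro p hp
    obtain ⟨x, rfl⟩ := (hroot p).1 hp
    rcases x with a | ⟨σ, s⟩ | k
    · exact Or.inl ((helt' _).2 ⟨a, rfl⟩)
    · classical
      exact Or.inr (Or.inr ⟨σ, fun i => e (.elt (s i)), fun i => (helt' _).2 ⟨_, rfl⟩,
        decide (P σ s), (hatom _ _ _ _).2 ⟨rfl, by simp⟩⟩)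
    · exact Or.inr (Or.inl ((hker' _).2 ⟨k, rfl⟩))
  · intro x y hx hy
    obtain ⟨x, rfl⟩ := (hroot x).1 hx
    obtain ⟨k, rfl⟩ := (hker' y).1 hy
    rw [hew, codeWeight_ker]
  · intro x y hx hy hyk hxy h
    obtain ⟨x, rfl⟩ := (hroot x).1 hx
    obtain ⟨y, rfl⟩ := (hroot y).1 hy
    rw [hew]
    rcases y with a | ⟨τ, t⟩ | l
    · rcases x with a' | ⟨σ, s⟩ | k
      · rfl
      · exfalso
        rcases h with h | h | h
        · obtain ⟨_, h⟩ := (helt' _).1 h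
          cases he h
        · obtain ⟨_, h⟩ := (hker' _).1 h
          cases he h
        · exact h ((helt' _).2 ⟨_, rfl⟩)
      · rfl
    · rcases x with a' | ⟨σ, s⟩ | k
      · rfl
      · have : (⟨σ, s⟩ : Σ σ, Fin (ar σ) → ℕ) ≠ ⟨τ, t⟩ := fun h' => by
          cases h'
          exact hxy rfl
        simp only [codeWeight, if_neg this]
      · rfl
    · exact absurd ((hker' _).2 ⟨l, rfl⟩) hyk

end CodeForests

/-! ### Codes are definable, and decoding is Borel -/

section DefinabilityOfCodes

open InfDefinable

variable {S : Type} [Encodable S] {ar : S → ℕ} {ι : Type}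

theorem InfDefinable.graphRel (i j : ι) : InfDefinable fun M w => graphRel M (w i) (w j) := by
  refine (relMap (L := ordGraph) (k := 2) OrdGraphRel.graph ![i, j]).congr fun M w => ?_
  have : (fun k => w (![i, j] k)) = ![w i, w j] := by funext k; fin_cases k <;> rfl
  rw [this]
  rfl

theorem InfDefinable.orderRel (i j : ι) : InfDefinable fun M w => orderRel M (w i) (w j) := by
  refine (relMap (L := ordGraph) (k := 2) OrdGraphRel.order ![i, j]).congr fun M w => ?_
  have : (fun k => w (![i, j] k)) = ![w i, w j] := by funext k; fin_cases k <;> rfl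
  rw [this]
  rfl

variable [Finite ι]

theorem InfDefinable.isRoot (i : ι) : InfDefinable fun M w => IsRoot M (w i) :=
  all (imp (InfDefinable.graphRel _ _) (var_eq _ _))

theorem InfDefinable.mem_kids (i j k : ι) :
    InfDefinable fun M w => w k ∈ kids M (w i) (w j) :=
  and (InfDefinable.graphRel _ _) (and (var_eq _ _).not (InfDefinable.orderRel _ _))

theorem InfDefinable.weight_eq (i j : ι) (n : ℕ) :
    InfDefinable fun M w => weight M (w i) (w j) = n :=
  encard_eq (Q := fun M w x => x ∈ kids M (w i) (w j)) (InfDefinable.mem_kids _ _ _) n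

theorem InfDefinable.weight_eq_zero (i j : ι) :
    InfDefinable fun M w => weight M (w i) (w j) = 0 :=
  (InfDefinable.weight_eq i j 0).congr fun M w => by simp

theorem InfDefinable.weight_eq_top (i j : ι) :
    InfDefinable fun M w => weight M (w i) (w j) = ⊤ :=
  encard_eq_top (Q := fun M w x => x ∈ kids M (w i) (w j)) (InfDefinable.mem_kids _ _ _)

theorem InfDefinable.isElt (i : ι) : InfDefinable fun M w => IsElt M (w i) :=
  and (InfDefinable.isRoot _) (InfDefinable.weight_eq_zero _ _)

theorem InfDefinable.isKer (i : ι) : InfDefinable fun M w => IsKer M (w i) :=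
  and (InfDefinable.isRoot _) (InfDefinable.weight_eq_top _ _)

/-- The right-hand side depends on the assignment only through the set `u` of positions where `w j`
occurs, so a conjunction over the finitely many `u` expresses it. -/
theorem InfDefinable.weight_eq_fiberCode {k : ℕ} (i j : ι) (s : Fin k → ι) :
    InfDefinable fun M w => weight M (w i) (w j) = (fiberCode (fun l => w (s l)) (w j) : ℕ) := by
  refine (forall_index (J := Finset (Fin k)) (P := fun u M w =>
    (∀ l, l ∈ u ↔ w (s l) = w j) → weight M (w i) (w j) = (Encodable.encode u : ℕ))
    fun u => imp (forall_index fun l => iff (const _) (var_eq _ _))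
      (InfDefinable.weight_eq _ _ _)).congr fun M w => ?_
  constructor
  · intro h u hu
    rw [h, fiberCode]
    congr 2
    ext l
    simp [hu]
  · intro h
    exact h _ fun l => by simp

theorem InfDefinable.isAtom (i : ι) (σ : S) (s : Fin (ar σ) → ι) (b : Bool) :
    InfDefinable fun M w => IsAtom M (w i) σ (fun l => w (s l)) b :=
  and (InfDefinable.isRoot _) (and (InfDefinable.weight_eq _ _ _)
    (all (imp (InfDefinable.isElt _)
      (InfDefinable.weight_eq_fiberCode (some i) none fun l => some (s l)))))

theorem InfDefinable.holds (σ : S) (s : Fin (ar σ) → ι) :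
    InfDefinable fun M w => Holds M σ (fun l => w (s l)) :=
  ex (InfDefinable.isAtom none σ (fun l => some (s l)) true)

theorem InfDefinable.isRootedForest :
    InfDefinable fun M (_ : ι → ℕ) => IsRootedForest M := by
  have h : InfDefinable fun M (_ : ι → ℕ) =>
      (∀ a, Linf.graphRel M a a) ∧
      (∀ a, ∀ b, Linf.graphRel M a b → a ≠ b → IsRoot M a) ∧
      (∀ a, ∀ b, ∀ c, Linf.graphRel M a c → Linf.graphRel M b c → a ≠ c → b ≠ c → a = b) ∧
      (∀ a, Linf.orderRel M a a) ∧
      (∀ a, ∀ b, Linf.orderRel M a b → Linf.orderRel M b a) ∧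
      (∀ a, ∀ b, ∀ c, Linf.orderRel M a b → Linf.orderRel M b c → Linf.orderRel M a c) ∧
      (∀ z, ∃ x, IsRoot M x ∧ Linf.orderRel M z x) ∧
      (∀ x, ∀ y, IsRoot M x → IsRoot M y → Linf.orderRel M x y → x = y) := by
    refine and (all (InfDefinable.graphRel _ _)) <|
      and (all (all (imp (InfDefinable.graphRel _ _) (imp (var_eq _ _).not (.isRoot _))))) <|
      and (all (all (all (imp (InfDefinable.graphRel _ _) (imp (InfDefinable.graphRel _ _)
        (imp (var_eq _ _).not (imp (var_eq _ _).not (var_eq _ _)))))))) <|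
      and (all (InfDefinable.orderRel _ _)) <|
      and (all (all (imp (InfDefinable.orderRel _ _) (InfDefinable.orderRel _ _)))) <|
      and (all (all (all (imp (InfDefinable.orderRel _ _) (imp (InfDefinable.orderRel _ _)
        (InfDefinable.orderRel _ _)))))) <|
      and (all (ex (and (InfDefinable.isRoot _) (InfDefinable.orderRel _ _)))) <|
      all (all (imp (InfDefinable.isRoot _) (imp (InfDefinable.isRoot _)
        (imp (InfDefinable.orderRel _ _) (var_eq _ _)))))
  refine h.congr fun M _ => ⟨fun h => ⟨h.refl, h.isRoot_of_lt, h.parent_unique,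
    h.equivalence.refl, fun a b => h.equivalence.symm, fun a b c => h.equivalence.trans,
    h.exists_root, h.root_unique⟩, ?_⟩
  rintro ⟨h1, h2, h3, h4, h5, h6, h7, h8⟩
  exact ⟨h1, h2, h3, ⟨h4, fun {a b} => h5 a b, fun {a b c} => h6 a b c⟩, h7, h8⟩

theorem InfDefinable.isCodeForest (ar : S → ℕ) :
    InfDefinable fun M (_ : ι → ℕ) => IsCodeForest ar M := by
  have h : InfDefinable fun M (_ : ι → ℕ) =>
      IsRootedForest M ∧ {x | IsElt M x}.encard = ⊤ ∧ {x | IsKer M x}.encard = ⊤ ∧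
      (∀ σ, ∀ s : Fin (ar σ) → ℕ, (∀ i, IsElt M (s i)) → ∃ p, ∃ b, IsAtom M p σ s b) ∧
      (∀ σ, ∀ s : Fin (ar σ) → ℕ, (∀ i, IsElt M (s i)) → ∀ b c, ∀ p, ∀ q,
        IsAtom M p σ s b → IsAtom M q σ s c → p = q) ∧
      (∀ p, IsRoot M p → IsElt M p ∨ IsKer M p ∨
        ∃ σ, ∃ s : Fin (ar σ) → ℕ, (∀ i, IsElt M (s i)) ∧ ∃ b, IsAtom M p σ s b) ∧
      (∀ x, ∀ y, IsRoot M x → IsKer M y → weight M x y = ⊤) ∧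
      (∀ x, ∀ y, IsRoot M x → IsRoot M y → ¬ IsKer M y → x ≠ y →
        (IsElt M x ∨ IsKer M x ∨ ¬ IsElt M y) → weight M x y = 0) := by
    refine and InfDefinable.isRootedForest <|
      and (encard_eq_top (InfDefinable.isElt _)) <|
      and (encard_eq_top (InfDefinable.isKer _)) <|
      and (forall_index fun σ => all_tuple (imp (forall_index fun i => InfDefinable.isElt _)
        (ex (exists_index fun b =>
          InfDefinable.isAtom none σ (fun l => some (Sum.inr l)) b)))) <|
      and (forall_index fun σ => all_tuple (imp (forall_index fun i => InfDefinable.isElt _)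
        (forall_index fun b => forall_index fun c => all (all (imp
          (InfDefinable.isAtom (some none) σ (fun l => some (some (Sum.inr l))) b)
          (imp (InfDefinable.isAtom none σ (fun l => some (some (Sum.inr l))) c)
            (var_eq _ _))))))) <|
      and (all (imp (InfDefinable.isRoot _) (or (InfDefinable.isElt _) (or (InfDefinable.isKer _)
        (exists_index fun σ => ex_tuple (and (forall_index fun i => InfDefinable.isElt _)
          (exists_index fun b =>
            InfDefinable.isAtom (Sum.inl none) σ (fun l => Sum.inr l) b))))))) <|
      and (all (all (imp (InfDefinable.isRoot _) (imp (InfDefinable.isKer _)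
        (InfDefinable.weight_eq_top _ _))))) <|
      all (all (imp (InfDefinable.isRoot _) (imp (InfDefinable.isRoot _)
        (imp (InfDefinable.isKer _).not (imp (var_eq _ _).not
          (imp (or (InfDefinable.isElt _) (or (InfDefinable.isKer _) (InfDefinable.isElt _).not))
            (InfDefinable.weight_eq_zero _ _)))))))
  refine h.congr fun M _ => ⟨fun h => ⟨h.1, h.2, h.3, h.4, h.5, h.6, h.7, h.8⟩, ?_⟩
  rintro ⟨h1, h2, h3, h4, h5, h6, h7, h8⟩
  exact ⟨h1, h2, h3, h4, h5, h6, h7, h8⟩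

/-- The node `x` is the `n`-th element iff it is an element with exactly `n` elements below it in
`ℕ`. -/
theorem measurableSet_eltEnum_eq {Y : Type*} [MeasurableSpace Y] {T : Y → Mod ordGraph}
    (hT : Measurable T) (hinf : ∀ y, {x | IsElt (T y) x}.Infinite) (n x : ℕ) :
    MeasurableSet {y | eltEnum (T y) n = x} := by
  classical
  have helt : ∀ x, MeasurableSet {y | IsElt (T y) x} := fun x =>
    hT ((InfDefinable.isElt (ι := Unit) ()).measurableSet fun _ => x)
  have hcount : ∀ x, Measurable fun y => Nat.count (IsElt (T y)) x := fun x => by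
    induction x with
    | zero => simp
    | succ x ih =>
      simp only [Nat.count_succ]
      exact ih.add (Measurable.ite (helt x) measurable_const measurable_const)
  have : {y | eltEnum (T y) n = x} =
      {y | IsElt (T y) x} ∩ {y | Nat.count (IsElt (T y)) x = n} := by
    ext y
    constructor
    · rintro rfl
      exact ⟨Nat.nth_mem_of_infinite (hinf y) n, Nat.count_nth_of_infinite (hinf y) n⟩
    · rintro ⟨h1, rfl⟩
      exact Nat.nth_count h1
  rw [this]
  exact (helt x).inter (hcount x (measurableSet_singleton n))

theorem measurableSet_decode {Y : Type*} [MeasurableSpace Y] {T : Y → Mod ordGraph}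
    (hT : Measurable T) (hcode : ∀ y, IsCodeForest ar (T y)) (σ : S) (s : Fin (ar σ) → ℕ) :
    MeasurableSet {y | decode ar (T y) σ s} := by
  have : {y | decode ar (T y) σ s} = ⋃ x : Fin (ar σ) → ℕ,
      (⋂ i, {y | eltEnum (T y) (s i) = x i}) ∩ {y | Holds (T y) σ x} := by
    ext y
    simp only [Set.mem_iUnion, Set.mem_inter_iff, Set.mem_iInter]
    constructor
    · intro h
      exact ⟨eltEnum (T y) ∘ s, fun i => rfl, h⟩
    · rintro ⟨x, hx, h⟩
      obtain rfl : eltEnum (T y) ∘ s = x := funext hx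
      exact h
  rw [this]
  exact MeasurableSet.iUnion fun x => (MeasurableSet.iInter fun i =>
    measurableSet_eltEnum_eq hT (fun y => (hcode y).infinite_elt) _ _).inter
      (hT ((InfDefinable.holds σ id).measurableSet x))

end DefinabilityOfCodes

/-! ### Structures as families of relations -/

section Structures

variable {L : FirstOrder.Language.{0, 0}}

/-- The arity of the relation representing a symbol: functions are represented by their graphs. -/
def symbolArity : L.Symbols → ℕ
  | .inl ⟨k, _⟩ => k + 1
  | .inr ⟨k, _⟩ => k

/-- The relations and the graphs of the functions of a structure. -/
def relFamily (M : Mod L) : RelFamily (symbolArity (L := L))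
  | .inl ⟨k, f⟩ => fun s : Fin (k + 1) → ℕ => M.funMap f (fun i => s i.castSucc) = s (Fin.last k)
  | .inr ⟨_, R⟩ => fun s => M.RelMap R s

theorem relFamily_fun (M : Mod L) {k : ℕ} (f : L.Functions k) (a : Fin k → ℕ) (b : ℕ) :
    relFamily M (.inl ⟨k, f⟩) (Fin.snoc a b : Fin (k + 1) → ℕ) ↔ M.funMap f a = b := by
  change M.funMap f (fun i => (Fin.snoc a b : Fin (k + 1) → ℕ) i.castSucc) =
    (Fin.snoc a b : Fin (k + 1) → ℕ) (Fin.last k) ↔ _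
  simp

theorem nonempty_equiv_iff {M N : Mod L} :
    Nonempty (@FirstOrder.Language.Equiv L ℕ ℕ M N) ↔ (relFamily M).Iso (relFamily N) := by
  constructor
  · rintro ⟨F⟩
    let h : ℕ ≃ ℕ := @FirstOrder.Language.Equiv.toEquiv L ℕ ℕ M N F
    refine ⟨h, ?_⟩
    rintro (⟨k, f⟩ | ⟨k, R⟩) s
    · have := @FirstOrder.Language.Equiv.map_fun' L ℕ ℕ M N F k f (fun i => s (Fin.castSucc i))
      exact (h.injective.eq_iff.symm).trans (Eq.congr_left this)
    · exact (@FirstOrder.Language.Equiv.map_rel' L ℕ ℕ M N F k R s).symm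
  · rintro ⟨h, hh⟩
    refine ⟨@FirstOrder.Language.Equiv.mk L ℕ ℕ M N h (fun {k} f a => ?_) (fun {k} R a => ?_)⟩
    · have h1 := (hh (.inl ⟨k, f⟩) (Fin.snoc a (M.funMap f a) : Fin (k + 1) → ℕ)).1
        ((relFamily_fun M f a _).2 rfl)
      have h2 : h ∘ (Fin.snoc a (M.funMap f a) : Fin (k + 1) → ℕ) =
          Fin.snoc (h ∘ a) (h (M.funMap f a)) := Fin.comp_snoc _ _ _
      exact ((relFamily_fun N f _ _).1 (h2 ▸ h1)).symm
    · exact (hh (.inr ⟨k, R⟩) a).symm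

/-- The relations representing function symbols are graphs of functions. -/
def IsFunctional (P : RelFamily (symbolArity (L := L))) : Prop :=
  ∀ (k : ℕ) (f : L.Functions k) (a : Fin k → ℕ),
    ∃! b, P (.inl ⟨k, f⟩) (Fin.snoc a b : Fin (k + 1) → ℕ)

theorem isFunctional_relFamily (M : Mod L) : IsFunctional (relFamily M) := fun _ f a =>
  ⟨M.funMap f a, (relFamily_fun M f a _).2 rfl, fun _ hb => ((relFamily_fun M f a _).1 hb).symm⟩

theorem IsFunctional.of_iso {P P' : RelFamily (symbolArity (L := L))} (hP : IsFunctional P)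
    (h : P.Iso P') : IsFunctional P' := by
  obtain ⟨h, hh⟩ := h
  intro k f a
  have key : ∀ b, P' (.inl ⟨k, f⟩) (Fin.snoc a (h b) : Fin (k + 1) → ℕ) ↔
      P (.inl ⟨k, f⟩) (Fin.snoc (h.symm ∘ a) b : Fin (k + 1) → ℕ) := fun b => by
    have h2 : h ∘ (Fin.snoc (h.symm ∘ a) b : Fin (k + 1) → ℕ) =
        (Fin.snoc a (h b) : Fin (k + 1) → ℕ) := by
      rw [Fin.comp_snoc, ← Function.comp_assoc, Equiv.self_comp_symm, Function.id_comp]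
    rw [← h2]
    exact (hh (.inl ⟨k, f⟩) _).symm
  obtain ⟨b, hb, hb'⟩ := hP k f (h.symm ∘ a)
  refine ⟨h b, (key b).2 hb, fun c hc => ?_⟩
  obtain ⟨c, rfl⟩ := h.surjective c
  rw [hb' c ((key c).1 hc)]

open Classical in
/-- The structure with the given relations and graphs of functions. -/
noncomputable abbrev ofRelFamily (P : RelFamily (symbolArity (L := L))) : Mod L where
  funMap := fun {k} f a =>
    -- The default `0` only makes the function total; it never occurs when `P` is functional.
    if h : ∃ b, P (.inl ⟨k, f⟩) (Fin.snoc a b : Fin (k + 1) → ℕ) then h.choose else 0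
  RelMap := fun {k} R a => P (.inr ⟨k, R⟩) a

theorem IsFunctional.funMap_ofRelFamily {P : RelFamily (symbolArity (L := L))}
    (hP : IsFunctional P) {k : ℕ} (f : L.Functions k) (a : Fin k → ℕ) (b : ℕ) :
    (ofRelFamily P).funMap f a = b ↔ P (.inl ⟨k, f⟩) (Fin.snoc a b : Fin (k + 1) → ℕ) := by
  have h := (hP k f a).exists
  have : (ofRelFamily P).funMap f a = h.choose := dif_pos h
  rw [this]
  constructor
  · rintro rfl
    exact h.choose_spec
  · exact (hP k f a).unique h.choose_spec

theorem IsFunctional.relFamily_ofRelFamily {P : RelFamily (symbolArity (L := L))}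
    (hP : IsFunctional P) : relFamily (ofRelFamily P) = P := by
  funext σ s
  rcases σ with ⟨k, f⟩ | ⟨k, R⟩
  · have hs : (Fin.snoc (fun i => s (Fin.castSucc i)) (s (Fin.last k)) : Fin (k + 1) → ℕ) = s :=
      Fin.snoc_init_self (α := fun _ => ℕ) s
    have := hP.funMap_ofRelFamily f (fun i => s (Fin.castSucc i)) (s (Fin.last k))
    rw [hs] at this
    exact propext this
  · rfl

theorem Formula.realize_equiv {A B : Type*} [L.Structure A] [L.Structure B] (g : L.Equiv A B)
    {n : ℕ} (φ : Formula L n) : ∀ w : Fin n → A, φ.Realize B (g ∘ w) ↔ φ.Realize A w := by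
  induction φ with
  | equal t₁ t₂ =>
    intro w
    simp only [Formula.Realize, FirstOrder.Language.HomClass.realize_term, g.injective.eq_iff]
  | rel R ts =>
    intro w
    simp only [Formula.Realize, FirstOrder.Language.HomClass.realize_term]
    exact g.map_rel R _
  | neg φ ih => exact fun w => not_congr (ih w)
  | conj φ ih => exact fun w => forall_congr' fun i => ih i w
  | all φ ih =>
    intro w
    refine g.surjective.forall.trans (forall_congr' fun a => ?_)
    rw [← ih]
    exact iff_of_eq (congrArg _ (Fin.comp_snoc _ _ _).symm)

theorem IsElementaryClass.mem_of_equiv {D : Set (Mod L)} (hD : IsElementaryClass D) {M N : Mod L}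
    (h : Nonempty (@FirstOrder.Language.Equiv L ℕ ℕ M N)) (hM : M ∈ D) : N ∈ D := by
  obtain ⟨φ, rfl⟩ := hD
  obtain ⟨g⟩ := h
  have := (@Formula.realize_equiv L ℕ ℕ M N g 0 φ Fin.elim0).2 hM
  exact (congrArg (@Formula.Realize L ℕ N 0 φ) (Subsingleton.elim _ _)).mp this

theorem measurableSet_relFamily (σ : L.Symbols) (s : Fin (symbolArity σ) → ℕ) :
    MeasurableSet {M : Mod L | relFamily M σ s} := by
  rcases σ with ⟨k, f⟩ | ⟨k, R⟩
  · exact measurableSet_funMap f _ _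
  · exact measurableSet_relMap R _

end Structures

/-! ### Translating sentences to codes -/

section Translation

open InfDefinable

variable {L : FirstOrder.Language.{0, 0}} [Encodable L.Symbols]

/-- The coded relations representing function symbols are graphs of functions. -/
def HasFunctions (L : FirstOrder.Language.{0, 0}) [Encodable L.Symbols] (T : Mod ordGraph) : Prop :=
  ∀ f : Σ k, L.Functions k, ∀ a : Fin f.1 → ℕ, (∀ i, IsElt T (a i)) →
    (∃ b, IsElt T b ∧ Holds T (ar := symbolArity (L := L)) (.inl f)
      (Fin.snoc a b : Fin (f.1 + 1) → ℕ)) ∧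
    ∀ b, ∀ c, IsElt T b → IsElt T c →
      Holds T (ar := symbolArity (L := L)) (.inl f) (Fin.snoc a b : Fin (f.1 + 1) → ℕ) →
      Holds T (ar := symbolArity (L := L)) (.inl f) (Fin.snoc a c : Fin (f.1 + 1) → ℕ) → b = c

/-- Decoding uses the order of `ℕ` through `eltEnum`, which no formula sees; `HasFunctions` speaks
of the nodes themselves. -/
theorem IsCodeForest.isFunctional_iff {T : Mod ordGraph}
    (hT : IsCodeForest (symbolArity (L := L)) T) :
    IsFunctional (decode (symbolArity (L := L)) T) ↔ HasFunctions L T := by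
  have key : ∀ (k : ℕ) (f : L.Functions k) (a : Fin k → ℕ) (b : ℕ),
      decode (symbolArity (L := L)) T (.inl ⟨k, f⟩) (Fin.snoc a b : Fin (k + 1) → ℕ) ↔
        Holds T (ar := symbolArity (L := L)) (.inl ⟨k, f⟩)
          (Fin.snoc (eltEnum T ∘ a) (eltEnum T b) : Fin (k + 1) → ℕ) := fun k f a b => by
    have : eltEnum T ∘ (Fin.snoc a b : Fin (k + 1) → ℕ) =
        (Fin.snoc (eltEnum T ∘ a) (eltEnum T b) : Fin (k + 1) → ℕ) := Fin.comp_snoc _ _ _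
    rw [← this]
    rfl
  constructor
  · rintro h ⟨k, f⟩ a ha
    choose a' ha' using fun i => hT.exists_eltEnum (ha i)
    obtain rfl : eltEnum T ∘ a' = a := funext ha'
    obtain ⟨b, hb, hb'⟩ := h k f a'
    refine ⟨⟨_, hT.isElt_eltEnum b, (key k f a' b).1 hb⟩, fun c d hc hd h1 h2 => ?_⟩
    obtain ⟨c, rfl⟩ := hT.exists_eltEnum hc
    obtain ⟨d, rfl⟩ := hT.exists_eltEnum hd
    rw [hb' c ((key k f a' c).2 h1), hb' d ((key k f a' d).2 h2)]
  · intro h k f a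
    obtain ⟨⟨b, hb, hab⟩, hu⟩ := h ⟨k, f⟩ (eltEnum T ∘ a) fun i => hT.isElt_eltEnum _
    obtain ⟨b, rfl⟩ := hT.exists_eltEnum hb
    refine ⟨b, (key k f a b).2 hab, fun c hc => hT.eltEnum_injective ?_⟩
    exact hu _ _ (hT.isElt_eltEnum c) hb ((key k f a c).1 hc) hab

theorem InfDefinable.holds_snoc {ι : Type} [Finite ι] {k : ℕ} (f : L.Functions k) (a : Fin k → ι)
    (b : ι) : InfDefinable fun M w => Holds M (ar := symbolArity (L := L)) (.inl ⟨k, f⟩)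
      (Fin.snoc (fun i => w (a i)) (w b) : Fin (k + 1) → ℕ) := by
  refine (InfDefinable.holds (ar := symbolArity (L := L)) (.inl ⟨k, f⟩)
    (Fin.snoc a b : Fin (k + 1) → ι)).congr fun M w => ?_
  have : (Fin.snoc (fun i => w (a i)) (w b) : Fin (k + 1) → ℕ) =
      w ∘ (Fin.snoc a b : Fin (k + 1) → ι) := (Fin.comp_snoc _ _ _).symm
  rw [this]
  rfl

theorem InfDefinable.hasFunctions {ι : Type} [Finite ι] :
    InfDefinable fun M (_ : ι → ℕ) => HasFunctions L M := by
  have : Countable (Σ k, L.Functions k) :=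
    (Sum.inl_injective (β := Σ k, L.Relations k)).countable
  refine forall_index fun f => all_tuple (imp (forall_index fun i => InfDefinable.isElt _) ?_)
  refine and (ex (and (InfDefinable.isElt _)
    (InfDefinable.holds_snoc f.2 (fun i => some (Sum.inr i)) none))) ?_
  exact all (all (imp (InfDefinable.isElt _) (imp (InfDefinable.isElt _) (imp
    (InfDefinable.holds_snoc f.2 (fun i => some (some (Sum.inr i))) (some none))
    (imp (InfDefinable.holds_snoc f.2 (fun i => some (some (Sum.inr i))) none)
      (var_eq _ _))))))

theorem IsCodeForest.exists_tuple_iff {T : Mod ordGraph}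
    (hT : IsCodeForest (symbolArity (L := L)) T) {k : ℕ} {p : (Fin k → ℕ) → Prop} :
    (∃ z : Fin k → ℕ, (∀ i, IsElt T (z i)) ∧ p z) ↔ ∃ z : Fin k → ℕ, p (eltEnum T ∘ z) := by
  constructor
  · rintro ⟨z, hz, h⟩
    choose z' hz' using fun i => hT.exists_eltEnum (hz i)
    exact ⟨z', (funext hz' : eltEnum T ∘ z' = z).symm ▸ h⟩
  · rintro ⟨z, h⟩
    exact ⟨_, fun i => hT.isElt_eltEnum _, h⟩

/-- The graph of `t` is defined, with `none` holding the value; the values of subterms are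
quantified existentially over the coded elements. -/
theorem exists_definable_term {n : ℕ} (t : L.Term (Fin n)) :
    ∃ Q : Mod ordGraph → (Option (Fin n) → ℕ) → Prop, InfDefinable Q ∧
      ∀ (T : Mod ordGraph) (M : Mod L), IsCodeForest (symbolArity (L := L)) T →
        relFamily M = decode (symbolArity (L := L)) T → ∀ (w : Fin n → ℕ) (b : ℕ),
          Q T (fun o => o.elim (eltEnum T b) (eltEnum T ∘ w)) ↔
            @FirstOrder.Language.Term.realize L ℕ M (Fin n) w t = b := by
  induction t with
  | var i =>
    exact ⟨_, var_eq (some i) none, fun T M hT hM w b => hT.eltEnum_injective.eq_iff⟩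
  | @func k f ts ih =>
    choose Q hQ h using ih
    refine ⟨fun T v => ∃ z : Fin k → ℕ, (∀ i, IsElt T (z i)) ∧
      (∀ i, Q i T fun o => o.elim (z i) fun j => v (some j)) ∧
      Holds T (ar := symbolArity (L := L)) (.inl ⟨k, f⟩)
        (Fin.snoc z (v none) : Fin (k + 1) → ℕ), ?_, fun T M hT hM w b => ?_⟩
    · refine ex_tuple (and (forall_index fun i => InfDefinable.isElt _) (and
        (forall_index fun i => ?_) (InfDefinable.holds_snoc f (fun i => Sum.inr i) (Sum.inl none))))
      refine ((hQ i).subst (κ := Option (Fin n) ⊕ Fin k)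
        fun o => o.elim (Sum.inr i) fun j => Sum.inl (some j)).congr fun M w => ?_
      refine iff_of_eq (congrArg _ (funext fun o => ?_))
      cases o <;> rfl
    · refine hT.exists_tuple_iff.trans ?_
      have h1 : ∀ z : Fin k → ℕ, Holds T (ar := symbolArity (L := L)) (.inl ⟨k, f⟩)
          (Fin.snoc (eltEnum T ∘ z) (eltEnum T b) : Fin (k + 1) → ℕ) ↔ M.funMap f z = b := fun z => by
        rw [← relFamily_fun, hM]
        have : eltEnum T ∘ (Fin.snoc z b : Fin (k + 1) → ℕ) =
          (Fin.snoc (eltEnum T ∘ z) (eltEnum T b) : Fin (k + 1) → ℕ) := Fin.comp_snoc _ _ _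
        rw [← this]
        rfl
      constructor
      · rintro ⟨z, hz, hzb⟩
        obtain rfl : (fun i => @FirstOrder.Language.Term.realize L ℕ M (Fin n) w (ts i)) = z :=
          funext fun i => (h i T M hT hM w (z i)).1 (hz i)
        exact (h1 _).1 hzb
      · intro hb
        exact ⟨fun i => @FirstOrder.Language.Term.realize L ℕ M (Fin n) w (ts i),
          fun i => (h i T M hT hM w _).2 rfl, (h1 _).2 hb⟩

/-- Quantifiers are relativised to the coded elements and atomic relations are replaced by `Holds`.
-/
theorem exists_definable_formula {n : ℕ} (φ : Formula L n) :
    ∃ Q : Mod ordGraph → (Fin n → ℕ) → Prop, InfDefinable Q ∧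
      ∀ (T : Mod ordGraph) (M : Mod L), IsCodeForest (symbolArity (L := L)) T →
        relFamily M = decode (symbolArity (L := L)) T → ∀ w : Fin n → ℕ,
          Q T (eltEnum T ∘ w) ↔ @Formula.Realize L ℕ M n φ w := by
  induction φ with
  | @equal n t₁ t₂ =>
    obtain ⟨Q₁, hQ₁, h₁⟩ := exists_definable_term t₁
    obtain ⟨Q₂, hQ₂, h₂⟩ := exists_definable_term t₂
    refine ⟨fun T v => ∃ x, IsElt T x ∧ (Q₁ T fun o => o.elim x v) ∧ Q₂ T fun o => o.elim x v,
      ?_, fun T M hT hM w => ?_⟩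
    · refine ex (and (InfDefinable.isElt _) (and
        ((hQ₁.subst id).congr fun M w => iff_of_eq (congrArg _ (funext fun o => ?_)))
        ((hQ₂.subst id).congr fun M w => iff_of_eq (congrArg _ (funext fun o => ?_))))) <;>
      cases o <;> rfl
    · constructor
      · rintro ⟨x, hx, h, h'⟩
        obtain ⟨b, rfl⟩ := hT.exists_eltEnum hx
        exact ((h₁ T M hT hM w b).1 h).trans ((h₂ T M hT hM w b).1 h').symm
      · intro h
        exact ⟨_, hT.isElt_eltEnum _, (h₁ T M hT hM w _).2 h, (h₂ T M hT hM w _).2 rfl⟩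
  | @rel n k R ts =>
    choose Q hQ h using fun i => exists_definable_term (ts i)
    refine ⟨fun T v => ∃ z : Fin k → ℕ, (∀ i, IsElt T (z i)) ∧
      (∀ i, Q i T fun o => o.elim (z i) v) ∧
      Holds T (ar := symbolArity (L := L)) (.inr ⟨k, R⟩) z, ?_, fun T M hT hM w => ?_⟩
    · refine ex_tuple (and (forall_index fun i => InfDefinable.isElt _) (and
        (forall_index fun i => ?_)
        (InfDefinable.holds (ar := symbolArity (L := L)) (.inr ⟨k, R⟩) fun i => Sum.inr i)))
      refine ((hQ i).subst (κ := Fin n ⊕ Fin k)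
        fun o => o.elim (Sum.inr i) fun j => Sum.inl j).congr fun M w => ?_
      refine iff_of_eq (congrArg _ (funext fun o => ?_))
      cases o <;> rfl
    · refine hT.exists_tuple_iff.trans ?_
      have h1 : ∀ z : Fin k → ℕ, Holds T (ar := symbolArity (L := L)) (.inr ⟨k, R⟩)
          (eltEnum T ∘ z) ↔ M.RelMap R z := fun z =>
        (iff_of_eq (congrFun (congrFun hM (.inr ⟨k, R⟩)) z)).symm
      constructor
      · rintro ⟨z, hz, hzR⟩
        obtain rfl : (fun i => @FirstOrder.Language.Term.realize L ℕ M (Fin n) w (ts i)) = z :=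
          funext fun i => (h i T M hT hM w (z i)).1 (hz i)
        exact (h1 _).1 hzR
      · intro hR
        exact ⟨fun i => @FirstOrder.Language.Term.realize L ℕ M (Fin n) w (ts i),
          fun i => (h i T M hT hM w _).2 rfl, (h1 _).2 hR⟩
  | neg φ ih =>
    obtain ⟨Q, hQ, h⟩ := ih
    exact ⟨_, hQ.not, fun T M hT hM w => not_congr (h T M hT hM w)⟩
  | conj φ ih =>
    choose Q hQ h using ih
    exact ⟨_, forall_nat hQ, fun T M hT hM w => forall_congr' fun i => h i T M hT hM w⟩
  | @all n φ ih =>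
    obtain ⟨Q, hQ, h⟩ := ih
    refine ⟨fun T v => ∀ x, IsElt T x → Q T (Fin.snoc v x), ?_, fun T M hT hM w => ?_⟩
    · refine InfDefinable.all (imp (InfDefinable.isElt _) ?_)
      refine (hQ.subst (κ := Option (Fin n))
        (Fin.snoc (fun i => some i) none : Fin (n + 1) → Option (Fin n))).congr fun M w => ?_
      exact iff_of_eq (congrArg _ (Fin.comp_snoc (α := Option (Fin n)) (β := ℕ) w
        (fun i => some i) none).symm)
    · have key : ∀ b, Q T (Fin.snoc (eltEnum T ∘ w) (eltEnum T b)) ↔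
          @Formula.Realize L ℕ M (n + 1) φ (Fin.snoc w b : Fin (n + 1) → ℕ) := fun b => by
        rw [← h T M hT hM]
        exact iff_of_eq (congrArg _ (Fin.comp_snoc _ _ _).symm)
      constructor
      · intro hx b
        exact (key b).1 (hx _ (hT.isElt_eltEnum b))
      · intro hb x hx
        obtain ⟨b, rfl⟩ := hT.exists_eltEnum hx
        exact (key b).2 (hb b)

/-- The class of the forests that code members of `D`. -/
def codeClass (D : Set (Mod L)) : Set (Mod ordGraph) :=
  {T | ∃ M ∈ D, IsCode (relFamily M) T}

/-- Any structure coded by `T` is isomorphic to the decoded one, and `D` is closed under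
isomorphism; this removes the quantifier over structures. -/
theorem mem_codeClass_iff {D : Set (Mod L)} (hD : IsElementaryClass D) {T : Mod ordGraph} :
    T ∈ codeClass D ↔ IsCodeForest (symbolArity (L := L)) T ∧
      IsFunctional (decode (symbolArity (L := L)) T) ∧
      ofRelFamily (decode (symbolArity (L := L)) T) ∈ D := by
  constructor
  · rintro ⟨M, hM, hT⟩
    have hc := hT.isCodeForest
    have hiso := hT.iso hc.isCode_decode
    have hfun := (isFunctional_relFamily M).of_iso hiso
    refine ⟨hc, hfun, hD.mem_of_equiv (nonempty_equiv_iff.2 ?_) hM⟩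
    rwa [hfun.relFamily_ofRelFamily]
  · rintro ⟨hc, hfun, hmem⟩
    refine ⟨_, hmem, ?_⟩
    rw [hfun.relFamily_ofRelFamily]
    exact hc.isCode_decode

theorem isElementaryClass_codeClass {D : Set (Mod L)} (hD : IsElementaryClass D) :
    IsElementaryClass (codeClass D) := by
  obtain ⟨φ, hφ⟩ := id hD
  obtain ⟨Q, hQ, h⟩ := exists_definable_formula φ
  obtain ⟨ψ, hψ⟩ := ((InfDefinable.isCodeForest (ι := Fin 0) (symbolArity (L := L))).and
    ((InfDefinable.hasFunctions (L := L)).and hQ)).exists_formula (Equiv.refl _)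
  refine ⟨ψ, Set.ext fun T => ?_⟩
  have h1 := hψ T Fin.elim0
  refine Iff.trans ?_ h1
  rw [mem_codeClass_iff hD]
  refine and_congr_right fun hc => ?_
  rw [← hc.isFunctional_iff]
  refine and_congr_right fun hfun => ?_
  have h2 := h T _ hc hfun.relFamily_ofRelFamily Fin.elim0
  rw [Subsingleton.elim (eltEnum T ∘ Fin.elim0) (Fin.elim0 : Fin 0 → ℕ)] at h2
  rw [h2, hφ]
  rfl

end Translation

/-! ### The classwise Borel isomorphism and the conclusion -/

theorem classwiseBorelIso_codeClass {L : FirstOrder.Language.{0, 0}} [Encodable L.Symbols]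
    {D : Set (Mod L)} (hD : IsElementaryClass D) :
    ClasswiseBorelIso (isoRel D) (isoRel (codeClass D)) := by
  obtain ⟨F, hF, hFm⟩ := exists_codeForest (symbolArity (L := L))
  have hiso : ∀ {P P' : RelFamily (symbolArity (L := L))} {T T' : Mod ordGraph},
      IsCode P T → IsCode P' T' →
      (P.Iso P' ↔ Nonempty (@FirstOrder.Language.Equiv ordGraph ℕ ℕ T T')) :=
    fun hT hT' => ⟨hT.equiv hT', fun h => (hT.of_equiv h).iso hT'⟩
  have hmem := fun T : codeClass D => (mem_codeClass_iff hD).1 T.2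
  have hcode : ∀ T : codeClass D,
      IsCode (relFamily (ofRelFamily (decode (symbolArity (L := L)) T.1))) T.1 := fun T => by
    rw [(hmem T).2.1.relFamily_ofRelFamily]
    exact (hmem T).1.isCode_decode
  -- The reductions are coding and decoding. By `hiso` and `hcode`, both composites stay in the
  -- isomorphism class.
  refine ⟨fun M => ⟨F (relFamily M.1), M.1, M.2, hF _⟩,
    fun T => ⟨ofRelFamily (decode _ T.1), (hmem T).2.2⟩, ⟨?_, ?_⟩, ⟨?_, ?_⟩, ?_, ?_⟩
  · exact Measurable.subtype_mk (hFm (fun M : D => relFamily M.1) fun σ s =>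
      measurable_subtype_coe (measurableSet_relFamily σ s))
  · exact fun M N => nonempty_equiv_iff.trans (hiso (hF _) (hF _))
  · have hdec := fun σ (s : Fin (symbolArity σ) → ℕ) =>
      measurableSet_decode (Y := codeClass D) measurable_subtype_coe (fun T => (hmem T).1) σ s
    refine Measurable.subtype_mk (measurable_to_mod (fun k R a => hdec (.inr ⟨k, R⟩) a)
      fun k f a b => ?_)
    have : {T : codeClass D | (ofRelFamily (decode (symbolArity (L := L)) T.1)).funMap f a = b} =
        {T : codeClass D | decode (symbolArity (L := L)) T.1 (.inl ⟨k, f⟩)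
          (Fin.snoc a b : Fin (k + 1) → ℕ)} :=
      Set.ext fun T => (hmem T).2.1.funMap_ofRelFamily f a b
    exact this ▸ hdec _ _
  · exact fun T T' => (nonempty_equiv_iff.trans (hiso (hcode T) (hcode T'))).symm
  · exact fun M => nonempty_equiv_iff.2 ((hcode _).iso (hF _))
  · exact fun T => (hiso (hF _) (hcode T)).1 ((hcode _).iso (hcode _))

theorem ClasswiseBorelIso.borelBireducible {X Y : Type*} [MeasurableSpace X] [MeasurableSpace Y]
    {E : X → X → Prop} {F : Y → Y → Prop} (h : ClasswiseBorelIso E F) : BorelBireducible E F := by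
  obtain ⟨f, g, hf, hg, -⟩ := h
  exact ⟨⟨f, hf⟩, ⟨g, hg⟩⟩

theorem BorelReducible.trans {X Y Z : Type*} [MeasurableSpace X] [MeasurableSpace Y]
    [MeasurableSpace Z] {E : X → X → Prop} {F : Y → Y → Prop} {G : Z → Z → Prop}
    (h : BorelReducible E F) (h' : BorelReducible F G) : BorelReducible E G := by
  obtain ⟨f, hf, hf'⟩ := h
  obtain ⟨g, hg, hg'⟩ := h'
  exact ⟨g ∘ f, hg.comp hf, fun x x' => (hf' x x').trans (hg' _ _)⟩

theorem ClasswiseBorelIso.of_measurableEquiv {X Y Z : Type*} [MeasurableSpace X]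
    [MeasurableSpace Y] [MeasurableSpace Z] {E : X → X → Prop} {F : Y → Y → Prop}
    {G : Z → Z → Prop} (e : X ≃ᵐ Y) (he : ∀ x x', E x x' ↔ F (e x) (e x'))
    (h : ClasswiseBorelIso F G) : ClasswiseBorelIso E G := by
  obtain ⟨f, g, hf, hg, hgf, hfg⟩ := h
  refine ⟨f ∘ e, e.symm ∘ g, ⟨hf.1.comp e.measurable, fun x x' => (he x x').trans (hf.2 _ _)⟩,
    ⟨e.symm.measurable.comp hg.1, fun y y' => ?_⟩, fun x => ?_, fun y => ?_⟩
  · rw [he]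
    simpa using hg.2 y y'
  · rw [he]
    simpa using hgf (e x)
  · simpa using hfg y

theorem codeClass_spec {L : FirstOrder.Language.{0, 0}} [Encodable L.Symbols]
    {D : Set (Mod L)} (hD : IsElementaryClass D) (hne : D.Nonempty) :
    IsElementaryClass (codeClass D) ∧
      (∀ M ∈ codeClass D, IsOrderedSetTheoreticalTree M ∧ Equivalence (orderRel M)) ∧
      (∀ M N : codeClass D, embedRel (codeClass D) M N) ∧
      embedRel (codeClass D) = biembedRel (codeClass D) ∧
      BorelBireducible (biembedRel (codeClass D)) (idRel 1) := by
  have hemb : ∀ M N : codeClass D, embedRel (codeClass D) M N := by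
    rintro ⟨T, M, _, hT⟩ ⟨T', M', _, hT'⟩
    exact hT.embedding hT'
  obtain ⟨f, -⟩ := classwiseBorelIso_codeClass hD
  -- A member of `D` gives a code, the image of the single point in the reduction of `id(1)`.
  obtain ⟨M, hM⟩ := hne
  refine ⟨isElementaryClass_codeClass hD, ?_, hemb, ?_, ⟨fun _ => 0, measurable_const, ?_⟩,
    ⟨fun _ => f ⟨M, hM⟩, measurable_const, ?_⟩⟩
  · rintro T ⟨M, _, hT⟩
    exact ⟨hT.1.isOrderedSetTheoreticalTree, hT.1.equivalence⟩
  · funext M N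
    exact propext ⟨fun h => ⟨h, hemb N M⟩, fun h => h.1⟩
  · exact fun M N => iff_of_true ⟨hemb M N, hemb N M⟩ rfl
  · exact fun i j => iff_of_true (Subsingleton.elim i j) ⟨hemb _ _, hemb _ _⟩

end Linf

theorem theorem3p1 {X : Type*} [MeasurableSpace X] [StandardBorelSpace X] [Nonempty X]
    (E : X → X → Prop) (hE : Linf.IsQuasiIsomorphismRelation E) :
    ∃ C : Set (Linf.Mod Linf.ordGraph), Linf.IsElementaryClass C ∧
      (∀ M ∈ C, Linf.IsOrderedSetTheoreticalTree M ∧ Equivalence (Linf.orderRel M)) ∧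
      Linf.BorelBireducible E (Linf.isoRel C) ∧
      (∀ M N : C, Linf.embedRel C M N) ∧
      Linf.embedRel C = Linf.biembedRel C ∧
      Linf.BorelBireducible (Linf.biembedRel C) (Linf.idRel 1) ∧
      (Linf.IsIsomorphismRelation E → Linf.ClasswiseBorelIso E (Linf.isoRel C)) := by
  obtain ⟨x⟩ := ‹Nonempty X›
  -- The classwise isomorphism needs a class `D` presenting `E` itself; otherwise a class merely
  -- bireducible with `E` is enough.
  by_cases hI : Linf.IsIsomorphismRelation E
  · obtain ⟨L, hL, D, hD, e, he⟩ := id hI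
    let _ : Encodable L.Symbols := Encodable.ofCountable _
    obtain ⟨h1, h2, h3, h4, h5⟩ := Linf.codeClass_spec hD ⟨_, (e x).2⟩
    have h6 := Linf.ClasswiseBorelIso.of_measurableEquiv e he (Linf.classwiseBorelIso_codeClass hD)
    exact ⟨Linf.codeClass D, h1, h2, h6.borelBireducible, h3, h4, h5, fun _ => h6⟩
  · obtain ⟨L, hL, D, hD, hED, hDE⟩ := hE
    let _ : Encodable L.Symbols := Encodable.ofCountable _
    obtain ⟨g, -⟩ := id hED
    obtain ⟨h1, h2, h3, h4, h5⟩ := Linf.codeClass_spec hD ⟨_, (g x).2⟩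
    obtain ⟨h6, h7⟩ := (Linf.classwiseBorelIso_codeClass hD).borelBireducible
    exact ⟨Linf.codeClass D, h1, h2, ⟨hED.trans h6, h7.trans hDE⟩, h3, h4, h5,
      fun h => absurd h hI⟩
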